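/- Let $\mathcal P$ be a simply connected open subset of $\mathbb C^r$, and let $D_1,\dots,D_m$ be pairwise disjoint closed disks in $\mathbb P^1(\mathbb C)$ (subsets homeomorphic to the closed unit disk). Let $\mathcal D$ be either $\mathbb P^1(\mathbb C)\setminus\bigcup_i D_i$ or $\mathbb P^1(\mathbb C)\setminus(\{\infty\}\cup\bigcup_i D_i)$, let $x_0\in\mathcal D$, and let $\gamma_1,\dots,\gamma_m$ be loops in $\mathcal D$ at $x_0$ generating $\pi_1(\mathcal D,x_0)$. Let $A_i:\mathcal P\to\mathfrak{gl}_n(\mathbb C)$ and $x_i:\mathcal P\to\mathbb C$ be analytic for $i=1,\dots,m$, with $x_i(t)\in D_i$ for all $t\in\mathcal P$, and consider $$\frac{dY}{dx}=\sum_{i=1}^m\frac{A_i(t)}{x-x_i(t)}\,Y .\qquad(1)$$ Assume that (1) is analytic on $\mathcal D\times\mathcal P$, that is, if $\infty\in\mathcal D$ then $\sum_i A_i(t)=0$ for all $t\in\mathcal P$. System (1) is called *projectively isomonodromic* if there are analytic functions $c_i:\mathcal P\to\mathbb C\setminus\{0\}$ and fixed matrices $G_i\in\mathrm{GL}_n(\mathbb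 C)$, $i=1,\dots,m$, such that for each $t\in\mathcal P$ there is a local fundamental solution $Y_t(x)$ of (1) at $x_0$ whose analytic continuation along $\gamma_i$ is $Y_t(x)\,G_i\,c_i(t)$ for each $i$. It is called *isomonodromic* if to every loop $\gamma$ in $\mathcal D$ at $x_0$ one can assign a matrix $\chi(\gamma)\in\mathrm{GL}_n(\mathbb C)$, not depending on $t$, such that for each $t\in\mathcal P$ there is a local fundamental solution $Y_t(x)$ at $x_0$ whose analytic continuation along every such $\gamma$ is $Y_t(x)\,\chi(\gamma)$; that is, the monodromy representations for the various $t$ are all conjugate to each other. Then (1) is projectively isomonodromic if and only if there exist analytic functions $b_i:\mathcal P\to\mathbb C$ and $B_i:\mathcal P\to\mathfrak{gl}_n(\mathbb C)$, $i=1,\dots,m$, such that 1. $A_i(t)=B_i(t)+b_i(t)I_n$ for all $t\in\mathcal P$ and $i=1,\dots,m$, and 2. the system $\dfrac{dY}{dx}=\sum_{i=1}^m\dfrac{B_i(t)}{x-x_i(t)}\,Y$ is analytic on $\mathcal D\times\mathcal P$ (that is, $\sum_i B_i(t)=0$ for all $t\in\mathcal P$ if $\infty\in\mathcal D$) and isomonodromic.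 -/

import Mathlib

open Filter Topology

noncomputable section

/-- A closed disk in a topological space (here the Riemann sphere): a subset homeomorphic to the
closed unit disk of the complex plane. Every round closed disk of the sphere is one. -/
def IsClosedDisk {X : Type*} [TopologicalSpace X] (K : Set X) : Prop :=
  Nonempty (K ≃ₜ Metric.closedBall (0 : ℂ) 1)

/-- The standard local parameter of the Riemann sphere `OnePoint ℂ` centred at `p`:
`z ↦ a + z` at a finite point `a`, and `w ↦ 1 / w` (with `0 ↦ ∞`) at `∞`. -/
def localParam (p : OnePoint ℂ) (z : ℂ) : OnePoint ℂ :=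
  match p with
  | none => if z = 0 then OnePoint.infty else ((z⁻¹ : ℂ) : OnePoint ℂ)
  | some a => ((a + z : ℂ) : OnePoint ℂ)

/-- A matrix valued function on the Riemann sphere is analytic at `p` (that is, in a neighbourhood
of `p`): its entries are analytic in the local parameter at `p`. -/
def MatrixAnalyticAt {n : ℕ} (Y : OnePoint ℂ → Matrix (Fin n) (Fin n) ℂ) (p : OnePoint ℂ) : Prop :=
  ∀ k l, AnalyticAt ℂ (fun z : ℂ => Y (localParam p z) k l) 0

/-- The coefficient matrix `∑ i, A i / (z - x i)` of a Fuchsian system, for one value of the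
parameter. -/
def fuchsianCoeff {m n : ℕ} (A : Fin m → Matrix (Fin n) (Fin n) ℂ) (x : Fin m → ℂ) (z : ℂ) :
    Matrix (Fin n) (Fin n) ℂ :=
  ∑ i, (z - x i)⁻¹ • A i

/-- `Y` is (a representative of the germ of) a local fundamental solution at `p` of
`dY/dz = (∑ i, A i / (z - x i)) Y`: it is analytic at `p`, it is invertible at `p`, and it
satisfies the equation at all finite points near `p`. -/
structure IsLocalFundamentalSolution {m n : ℕ} (A : Fin m → Matrix (Fin n) (Fin n) ℂ)
    (x : Fin m → ℂ) (p : OnePoint ℂ) (Y : OnePoint ℂ → Matrix (Fin n) (Fin n) ℂ) : Prop where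
  analytic : MatrixAnalyticAt Y p
  invertible : IsUnit (Y p)
  equation : ∀ᶠ z : ℂ in comap ((↑) : ℂ → OnePoint ℂ) (𝓝 p), ∀ k l,
    HasDerivAt (fun w : ℂ => Y (w : OnePoint ℂ) k l)
      ((fuchsianCoeff A x z * Y (z : OnePoint ℂ)) k l) z

/-- The family of germs `F s` at `γ s`, for `s ∈ [0, 1]`, is an analytic continuation along `γ`. -/
structure IsAnalyticContinuation {n : ℕ} (γ : unitInterval → OnePoint ℂ)
    (F : unitInterval → OnePoint ℂ → Matrix (Fin n) (Fin n) ℂ) : Prop where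
  analytic : ∀ s, MatrixAnalyticAt (F s) (γ s)
  compatible : ∀ s, ∀ᶠ s' in 𝓝 s, F s' =ᶠ[𝓝 (γ s')] F s

/-- Analytic continuation of the germ of `Y` at the starting point of `γ` along `γ` yields the germ
of `Z` at the end point of `γ`. -/
def ContinuesTo {n : ℕ} {D : Set (OnePoint ℂ)} {p q : D} (γ : Path p q)
    (Y Z : OnePoint ℂ → Matrix (Fin n) (Fin n) ℂ) : Prop :=
  ∃ F : unitInterval → OnePoint ℂ → Matrix (Fin n) (Fin n) ℂ,
    IsAnalyticContinuation (fun s => (γ s : OnePoint ℂ)) F ∧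
      F 0 =ᶠ[𝓝 (p : OnePoint ℂ)] Y ∧ F 1 =ᶠ[𝓝 (q : OnePoint ℂ)] Z

/-- The parametrized Fuchsian system with residues `A i t` at `x i t` is isomonodromic over `P`,
on the domain `D` with base point `x₀`: with respect to suitable local fundamental solutions
`Y_t` at `x₀`, the monodromy matrix of every loop of `D` at `x₀` is independent of `t`. (Changing
`Y_t` conjugates the monodromy representation, so this says that all the monodromy
representations of the fundamental group are conjugate to each other.) -/
def IsIsomonodromic {m n r : ℕ} (P : Set (Fin r → ℂ)) {D : Set (OnePoint ℂ)} (x₀ : D)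
    (A : Fin m → (Fin r → ℂ) → Matrix (Fin n) (Fin n) ℂ) (x : Fin m → (Fin r → ℂ) → ℂ) : Prop :=
  ∃ χ : Path x₀ x₀ → GL (Fin n) ℂ, ∀ t ∈ P,
    ∃ Y : OnePoint ℂ → Matrix (Fin n) (Fin n) ℂ,
      IsLocalFundamentalSolution (fun i => A i t) (fun i => x i t) x₀ Y ∧
      ∀ γ : Path x₀ x₀, ContinuesTo γ Y (fun p => Y p * (χ γ : Matrix (Fin n) (Fin n) ℂ))

/-- The parametrized Fuchsian system with residues `A i t` at `x i t` is projectively isomonodromic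
over `P`, with respect to the loops `γ i` at `x₀`: there are fixed invertible matrices `G i`
and analytic nowhere vanishing functions `c i` on `P` such that, for every `t`, some local
fundamental solution at `x₀` has monodromy matrix `c i t • G i` along `γ i`, for each `i`. -/
def IsProjectivelyIsomonodromic {m n r : ℕ} (P : Set (Fin r → ℂ)) {D : Set (OnePoint ℂ)} {x₀ : D}
    (γ : Fin m → Path x₀ x₀)
    (A : Fin m → (Fin r → ℂ) → Matrix (Fin n) (Fin n) ℂ) (x : Fin m → (Fin r → ℂ) → ℂ) : Prop :=
  ∃ (c : Fin m → (Fin r → ℂ) → ℂ) (G : Fin m → GL (Fin n) ℂ),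
    (∀ i, AnalyticOnNhd ℂ (c i) P) ∧ (∀ i, ∀ t ∈ P, c i t ≠ 0) ∧
    ∀ t ∈ P, ∃ Y : OnePoint ℂ → Matrix (Fin n) (Fin n) ℂ,
      IsLocalFundamentalSolution (fun i => A i t) (fun i => x i t) x₀ Y ∧
      ∀ i, ContinuesTo (γ i) Y (fun p => Y p * (c i t • (G i : Matrix (Fin n) (Fin n) ℂ)))

end

/-!
The key observation is that the scalar part of a projectively isomonodromic system can be split off
by taking traces. Put `b i = tr (A i) / n` and `B i = A i - b i • 1`. If `y` solves the scalar
equation `y' = (∑ i, b i / (z - x i)) y` and `Y` is a fundamental solution of the given system,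
then `y⁻¹ • Y` is a fundamental solution of the trace-free system, and its monodromy along `γ i` is
`(c i t / d i t) • G i`, where `d i t` is the monodromy of `y`. By Liouville's formula the
determinant of a solution of a trace-free system is constant, so that
`(c i t / d i t) ^ n * det (G i) = 1`. As `c i / d i` is continuous on the connected set `P`, it
is constant
(`IsProjectivelyIsomonodromic.isIsomonodromic_traceless`). Monodromy which is constant on generators
of the fundamental group is constant (`isIsomonodromic_of_generators`). Conversely, multiplying the
solutions of an isomonodromic system by `y` multiplies the monodromy by the scalars `d i t`, which
depend analytically on `t` (`IsIsomonodromic.isProjectivelyIsomonodromic_add_smul`).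

Both directions rest on the continuation of solutions along all loops and its invariance under
homotopy. Local fundamental solutions are frames of a flat principal bundle: any two of them differ
by a locally constant factor. The bundle with discrete fibers glued from these factors is a covering
space, and lifting of paths and homotopies in it gives the monodromy representation
(`FlatFrames.exists_holonomy`, `exists_monodromy`). For the scalar equation the structure group is
taken to be the group of nowhere vanishing analytic functions on `P`, with the frames
`∏ i, (1 + α i * w) ^ b i`; the monodromy then lies in this group, so `d i` is analytic.
In the matrix case the local solutions are constructed as power series
(`exists_linearODE_solution`). The uniqueness of analytic continuation
(`IsGermContinuation.eventuallyEq`) compares arbitrary continuations with these.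
-/

/-! ### Flat frames and their holonomy -/

/-- A cover of `X` by open sets `dom p ∋ p` with maps `frame p : dom p → G` (extended by junk) whose
transition functions `(frame q)⁻¹ * frame p` are locally constant on overlaps. These are the local
trivializations of a flat principal `G`-bundle: the typical example is a choice of local fundamental
solutions of a linear differential equation. -/
structure FlatFrames (X G : Type*) [TopologicalSpace X] [Group G] where
  /-- The domain of the frame centred at a point. -/
  dom : X → Set X
  isOpen_dom : ∀ p, IsOpen (dom p)
  mem_dom : ∀ p, p ∈ dom p
  /-- The frame centred at a point. -/
  frame : X → X → G
  locallyConst : ∀ p q x, x ∈ dom p → x ∈ dom q →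
    ∀ᶠ y in 𝓝 x, (frame q y)⁻¹ * frame p y = (frame q x)⁻¹ * frame p x

namespace FlatFrames

variable {X G : Type*} [TopologicalSpace X] [Group G]

/-- The family `g s` of coordinates, with respect to the frames centred at `γ s`, describes a flat
section along `γ`. -/
def IsTransport (L : FlatFrames X G) (γ : unitInterval → X) (g : unitInterval → G) : Prop :=
  ∀ s, ∀ᶠ s' in 𝓝 s, L.frame (γ s') (γ s') * g s' = L.frame (γ s) (γ s') * g s

section Bundle

variable [TopologicalSpace G] [DiscreteTopology G] (L : FlatFrames X G)

/-- The fiber bundle with discrete fiber `G` (hence a covering space of `X`) glued from the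
transition functions of `L`. The fiber over `x` is identified with `G` by the frame centred at
`x`. -/
def bundleCore : FiberBundleCore X X G where
  baseSet := L.dom
  isOpen_baseSet := L.isOpen_dom
  indexAt := id
  mem_baseSet_at := L.mem_dom
  coordChange p q x v := (L.frame q x)⁻¹ * L.frame p x * v
  coordChange_self p x _ v := by simp
  continuousOn_coordChange p q := by
    rintro ⟨x, v⟩ ⟨⟨hp, hq⟩, -⟩
    refine ContinuousAt.continuousWithinAt ?_
    have h : ∀ᶠ z : X × G in 𝓝 (x, v), (L.frame q x)⁻¹ * L.frame p x * z.2 =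
        (L.frame q z.1)⁻¹ * L.frame p z.1 * z.2 := by
      filter_upwards [continuous_fst.continuousAt.eventually (L.locallyConst p q x hp hq)]
        with z hz
      rw [hz]
    refine ContinuousAt.congr ?_ h
    exact ((continuous_of_discreteTopology
      (f := fun u : G => (L.frame q x)⁻¹ * L.frame p x * u)).comp continuous_snd).continuousAt
  coordChange_comp p q r x _ v := by group

theorem isCoveringMap_proj : IsCoveringMap L.bundleCore.proj :=
  FiberBundle.isCoveringMap (F := G) (E := L.bundleCore.Fiber)

/-- The point with coordinate `v` in the fiber over `x`. -/
def point (x : X) (v : G) : L.bundleCore.TotalSpace := ⟨x, v⟩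

/-- The coordinate of a point of the covering space, in the frame centred at its projection. -/
def coord (z : L.bundleCore.TotalSpace) : G := z.2

theorem coord_point (x : X) (v : G) : L.coord (L.point x v) = v := rfl

theorem continuous_iff_isTransport {γ : unitInterval → X} (hγ : Continuous γ)
    (g : unitInterval → G) :
    Continuous (fun s => L.point (γ s) (g s)) ↔ L.IsTransport γ g := by
  rw [continuous_iff_continuousAt]
  refine forall_congr' fun s => ?_
  let e := L.bundleCore.localTrivAt (γ s)
  have hpre : (fun s' => L.point (γ s') (g s')) ⁻¹' e.source ∈ 𝓝 s :=
    hγ.continuousAt.preimage_mem_nhds ((L.isOpen_dom (γ s)).mem_nhds (L.mem_dom (γ s)))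
  rw [e.toOpenPartialHomeomorph.continuousAt_iff_continuousAt_comp_left hpre]
  have h1 : (e.toOpenPartialHomeomorph ∘ fun s => L.point (γ s) (g s)) = fun s' =>
      (γ s', (L.frame (γ s) (γ s'))⁻¹ * L.frame (γ s') (γ s') * g s') := rfl
  rw [h1, ContinuousAt, nhds_prod_eq, tendsto_prod_iff']
  refine (and_iff_right hγ.continuousAt).trans ?_
  rw [nhds_discrete G, tendsto_pure]
  refine eventually_congr (Eventually.of_forall fun s' => ?_)
  constructor
  · intro h
    have := congrArg (L.frame (γ s) (γ s') * ·) h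
    simpa [mul_assoc] using this
  · intro h
    rw [mul_assoc, h]
    group

/-- Right translations act on the covering space. -/
theorem continuous_point_mul (v : G) :
    Continuous fun z : L.bundleCore.TotalSpace => L.point z.1 (L.coord z * v) := by
  rw [continuous_iff_continuousAt]
  intro z
  let e := L.bundleCore.localTrivAt z.1
  have hz : z ∈ e.source := L.mem_dom z.1
  have hc : ContinuousAt (fun z : L.bundleCore.TotalSpace => z.1) z :=
    L.bundleCore.continuous_proj.continuousAt
  have hpre : (fun w => L.point w.1 (L.coord w * v)) ⁻¹' e.source ∈ 𝓝 z :=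
    hc.preimage_mem_nhds ((L.isOpen_dom z.1).mem_nhds (L.mem_dom z.1))
  rw [e.toOpenPartialHomeomorph.continuousAt_iff_continuousAt_comp_left hpre]
  have h1 : (e.toOpenPartialHomeomorph ∘ fun z : L.bundleCore.TotalSpace =>
      L.point z.1 (L.coord z * v)) = fun w => ((e w).1, (e w).2 * v) := by
    funext w
    exact Prod.ext rfl (mul_assoc _ _ _).symm
  rw [h1]
  have he : ContinuousAt e z := e.continuousAt hz
  have : Continuous fun p : X × G => (p.1, p.2 * v) :=
    continuous_fst.prodMk ((continuous_of_discreteTopology (f := fun u : G => u * v)).comp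
      continuous_snd)
  exact this.continuousAt.comp he

end Bundle

/-- Flat sections of a system of flat frames can be continued along all paths, and their monodromy
is a representation of the fundamental group. -/
theorem exists_holonomy (L : FlatFrames X G) (x₀ : X) :
    ∃ hol : FundamentalGroup X x₀ →* G, ∀ γ : Path x₀ x₀, ∃ g : unitInterval → G,
      L.IsTransport γ g ∧ g 0 = 1 ∧
        g 1 = hol (FundamentalGroup.fromPath (Path.Homotopic.Quotient.mk γ)) := by
  let _ : TopologicalSpace G := ⊥
  have : DiscreteTopology G := ⟨rfl⟩
  have cov := L.isCoveringMap_proj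
  let base (v : G) : L.bundleCore.proj ⁻¹' {x₀} := ⟨L.point x₀ v, rfl⟩
  let coord (z : L.bundleCore.proj ⁻¹' {x₀}) : G := L.coord z
  have base_coord (z) : base (coord z) = z := by
    obtain ⟨⟨x, v⟩, rfl⟩ := z
    rfl
  -- the monodromy commutes with right translations
  have key (p : FundamentalGroup X x₀) (v : G) :
      cov.monodromy p (base v) = base (coord (cov.monodromy p (base 1)) * v) := by
    induction p using Path.Homotopic.Quotient.ind with
    | mk γ =>
      have hlift := cov.liftPath_lifts γ.toContinuousMap (base 1) (γ.source.trans (base 1).2.symm)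
      have hzero := cov.liftPath_zero γ.toContinuousMap (base 1) (γ.source.trans (base 1).2.symm)
      let Γ := cov.liftPath γ.toContinuousMap (base 1) (γ.source.trans (base 1).2.symm)
      have h : (fun s => L.point (Γ s).1 (L.coord (Γ s) * v)) =
          cov.liftPath γ.toContinuousMap (base v) (γ.source.trans (base v).2.symm) := by
        rw [cov.eq_liftPath_iff]
        refine ⟨(L.continuous_point_mul v).comp Γ.continuous, hlift, ?_⟩
        change L.point (Γ 0).1 (L.coord (Γ 0) * v) = L.point x₀ v
        rw [show Γ 0 = L.point x₀ 1 from hzero]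
        change L.point x₀ (1 * v) = _
        rw [one_mul]
      have hend : (Γ 1).1 = x₀ := (congrFun hlift 1).trans γ.target
      refine Subtype.ext ?_
      refine (congrFun h 1).symm.trans ?_
      change L.point (Γ 1).1 _ = L.point x₀ _
      rw [hend]
      rfl
  refine ⟨⟨⟨fun p => coord (cov.monodromyPerm x₀ p (base 1)), ?_⟩, ?_⟩, ?_⟩
  · exact (congrArg coord (DFunLike.congr_fun (map_one (cov.monodromyPerm x₀)) (base 1)))
  · intro p q
    have h1 : cov.monodromyPerm x₀ (p * q) (base 1) =
        cov.monodromyPerm x₀ p (base (coord (cov.monodromyPerm x₀ q (base 1)))) := by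
      rw [map_mul, base_coord]
      rfl
    exact (congrArg coord h1).trans (congrArg coord (key p _))
  · intro γ
    have hlift := cov.liftPath_lifts γ.toContinuousMap (base 1) (γ.source.trans (base 1).2.symm)
    have hzero := cov.liftPath_zero γ.toContinuousMap (base 1) (γ.source.trans (base 1).2.symm)
    let Γ := cov.liftPath γ.toContinuousMap (base 1) (γ.source.trans (base 1).2.symm)
    refine ⟨fun s => L.coord (Γ s), ?_, ?_, rfl⟩
    · rw [← L.continuous_iff_isTransport γ.continuous]
      have : (fun s => L.point (γ s) (L.coord (Γ s))) = Γ := by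
        funext s
        have hs : (Γ s).1 = γ s := congrFun hlift s
        change L.point (γ s) _ = L.point (Γ s).1 _
        rw [← hs]
        rfl
      rw [this]
      exact Γ.continuous
    · change L.coord (Γ 0) = 1
      rw [show Γ 0 = L.point x₀ 1 from hzero, coord_point]

end FlatFrames

/-! ### Linear differential equations with values in a Banach algebra -/

section LinearODE

variable {𝔸 : Type*} [NormedRing 𝔸] [NormedAlgebra ℂ 𝔸]

/-- The Taylor coefficients at `0` of the solution `W` with `W 0 = 1` of `W' = C W`, where
`C w = ∑ k, w ^ k • c k`. -/
noncomputable def linearODECoeff (c : ℕ → 𝔸) : ℕ → 𝔸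
  | 0 => 1
  | k + 1 => ((k : ℂ) + 1)⁻¹ • ∑ i : Fin (k + 1), c (k - i) * linearODECoeff c i

theorem norm_linearODECoeff_le {c : ℕ → 𝔸} {M R : ℝ} (hM : 0 ≤ M) (hR : 0 ≤ R)
    (hc : ∀ k, ‖c k‖ ≤ M * R ^ k) (k : ℕ) :
    ‖linearODECoeff c k‖ ≤ ‖(1 : 𝔸)‖ * (R + M) ^ k := by
  induction k using Nat.strong_induction_on with
  | _ k ih =>
    cases k with
    | zero => simp [linearODECoeff]
    | succ k =>
      have hk : (0 : ℝ) < k + 1 := by positivity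
      have hterm (i : Fin (k + 1)) :
          ‖c (k - i) * linearODECoeff c i‖ ≤ M * (‖(1 : 𝔸)‖ * (R + M) ^ k) := by
        have hik : (i : ℕ) ≤ k := Nat.lt_succ_iff.mp i.2
        calc ‖c (k - i) * linearODECoeff c i‖ ≤ ‖c (k - i)‖ * ‖linearODECoeff c i‖ :=
              norm_mul_le _ _
          _ ≤ (M * R ^ (k - (i : ℕ))) * (‖(1 : 𝔸)‖ * (R + M) ^ (i : ℕ)) :=
              mul_le_mul (hc _) (ih i i.2) (norm_nonneg _) (by positivity)
          _ ≤ (M * (R + M) ^ (k - (i : ℕ))) * (‖(1 : 𝔸)‖ * (R + M) ^ (i : ℕ)) := by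
              gcongr
              linarith
          _ = M * (‖(1 : 𝔸)‖ * ((R + M) ^ (k - (i : ℕ)) * (R + M) ^ (i : ℕ))) := by ring
          _ = M * (‖(1 : 𝔸)‖ * (R + M) ^ k) := by rw [← pow_add, Nat.sub_add_cancel hik]
      rw [linearODECoeff, norm_smul, norm_inv,
        show ‖(k : ℂ) + 1‖ = k + 1 by exact_mod_cast Complex.norm_natCast (k + 1)]
      rw [inv_mul_le_iff₀ hk]
      calc ‖∑ i : Fin (k + 1), c (k - i) * linearODECoeff c i‖
          ≤ ∑ _i : Fin (k + 1), M * (‖(1 : 𝔸)‖ * (R + M) ^ k) :=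
            norm_sum_le_of_le _ fun i _ => hterm i
        _ = (k + 1) * (M * (‖(1 : 𝔸)‖ * (R + M) ^ k)) := by simp
        _ ≤ (k + 1) * (‖(1 : 𝔸)‖ * (R + M) ^ (k + 1)) := by
            have h : 0 ≤ R * (‖(1 : 𝔸)‖ * (R + M) ^ k) := by positivity
            refine mul_le_mul_of_nonneg_left ?_ hk.le
            rw [pow_succ]
            linarith

/-- A linear differential equation with analytic coefficient has a local solution with initial
value `1`. -/
theorem exists_linearODE_solution [CompleteSpace 𝔸] {c : ℕ → 𝔸} {M R : ℝ} (hM : 0 ≤ M)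
    (hR : 0 ≤ R) (hc : ∀ k, ‖c k‖ ≤ M * R ^ k) :
    ∃ r > 0, ∃ W : ℂ → 𝔸, W 0 = 1 ∧
      ∀ w ∈ Metric.ball (0 : ℂ) r, HasDerivAt W ((∑' k, w ^ k • c k) * W w) w := by
  -- the summand `1` makes `S` positive, and the radius `1 / (2 * S)` makes the series geometric
  set S : ℝ := R + M + 1 with hS
  have hS0 : 0 < S := by positivity
  set y := linearODECoeff c with hy
  have hyS (k : ℕ) : ‖y k‖ ≤ ‖(1 : 𝔸)‖ * S ^ k :=
    (norm_linearODECoeff_le hM hR hc k).trans (by gcongr; linarith)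
  have hcS (k : ℕ) : ‖c k‖ ≤ M * S ^ k :=
    (hc k).trans (by gcongr; linarith)
  have hgeom (w : ℂ) (hw : w ∈ Metric.ball (0 : ℂ) (2 * S)⁻¹) (k : ℕ) :
      ‖w‖ ^ k ≤ (1 / 2 : ℝ) ^ k * (S ^ k)⁻¹ := by
    rw [mem_ball_zero_iff] at hw
    rw [← inv_pow, ← mul_pow]
    refine pow_le_pow_left₀ (norm_nonneg _) (hw.le.trans (le_of_eq ?_)) k
    rw [mul_inv]
    ring
  have hsum (a : ℕ → 𝔸) (B : ℝ) (ha : ∀ k, ‖a k‖ ≤ B * S ^ k) (w : ℂ)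
      (hw : w ∈ Metric.ball (0 : ℂ) (2 * S)⁻¹) : Summable fun k => ‖w ^ k • a k‖ := by
    refine Summable.of_nonneg_of_le (fun _ => norm_nonneg _) (fun k => ?_)
      ((summable_geometric_of_lt_one (r := 1 / 2) (by norm_num) (by norm_num)).mul_left B)
    rw [norm_smul, norm_pow]
    calc ‖w‖ ^ k * ‖a k‖ ≤ ((1 / 2 : ℝ) ^ k * (S ^ k)⁻¹) * (B * S ^ k) :=
          mul_le_mul (hgeom w hw k) (ha k) (norm_nonneg _) (by positivity)
      _ = B * (1 / 2) ^ k := by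
          have : S ^ k ≠ 0 := by positivity
          field_simp
  refine ⟨(2 * S)⁻¹, by positivity, fun w => ∑' k, w ^ k • y k, ?_, ?_⟩
  · beta_reduce
    rw [tsum_eq_single 0]
    · simp [hy, linearODECoeff]
    · intro k hk
      simp [hk]
  · intro w hw
    have hbound : Summable fun k : ℕ => 2 * S * ‖(1 : 𝔸)‖ * (((k : ℝ) ^ 1) * (1 / 2) ^ k) :=
      (summable_pow_mul_geometric_of_norm_lt_one 1 (r := (1 / 2 : ℝ)) (by norm_num)).mul_left _
    have hle (k : ℕ) (w : ℂ) (hw : w ∈ Metric.ball (0 : ℂ) (2 * S)⁻¹) :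
        ‖((k : ℂ) * w ^ (k - 1)) • y k‖ ≤ 2 * S * ‖(1 : 𝔸)‖ * (((k : ℝ) ^ 1) * (1 / 2) ^ k) := by
      cases k with
      | zero => simp
      | succ k =>
        rw [norm_smul, norm_mul, norm_pow, Complex.norm_natCast, Nat.add_sub_cancel, pow_one]
        calc ((k + 1 : ℕ) : ℝ) * ‖w‖ ^ k * ‖y (k + 1)‖
            ≤ ((k + 1 : ℕ) : ℝ) * ((1 / 2 : ℝ) ^ k * (S ^ k)⁻¹) * (‖(1 : 𝔸)‖ * S ^ (k + 1)) := by
              gcongr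
              · exact hgeom w hw k
              · exact hyS _
          _ = 2 * S * ‖(1 : 𝔸)‖ * (((k + 1 : ℕ) : ℝ) * (1 / 2) ^ (k + 1)) := by
              have : S ^ k ≠ 0 := by positivity
              field_simp
              ring
    have hder := hasDerivAt_tsum_of_isPreconnected (𝕜 := ℂ)
      (g := fun k w => w ^ k • y k) (g' := fun k w => ((k : ℂ) * w ^ (k - 1)) • y k)
      hbound Metric.isOpen_ball (convex_ball (0 : ℂ) _).isPreconnected
      (fun k w _ => (hasDerivAt_pow k w).smul_const (y k)) hle
      (Metric.mem_ball_self (by positivity)) ?_ hw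
    · refine hder.congr_deriv (Eq.symm ?_)
      have hsummable : Summable fun k : ℕ => ((k : ℂ) * w ^ (k - 1)) • y k :=
        Summable.of_norm_bounded hbound fun k => hle k w hw
      beta_reduce
      rw [hsummable.tsum_eq_zero_add, tsum_mul_tsum_eq_tsum_sum_range_of_summable_norm
        (hsum c M hcS w hw) (hsum y _ hyS w hw)]
      simp only [Nat.cast_zero, zero_mul, zero_smul, zero_add, Nat.add_sub_cancel]
      refine tsum_congr fun k => ?_
      have hk : ((k + 1 : ℕ) : ℂ) ≠ 0 := by exact_mod_cast k.succ_ne_zero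
      rw [hy, linearODECoeff, ← Nat.cast_succ, Nat.succ_eq_add_one, mul_comm _ (w ^ k), smul_smul,
        mul_assoc, mul_inv_cancel₀ hk, mul_one, Finset.smul_sum, ← Finset.sum_range_reflect,
        Finset.sum_range]
      refine Finset.sum_congr rfl fun i _ => ?_
      have hik : (i : ℕ) ≤ k := Nat.lt_succ_iff.mp i.2
      rw [show k + 1 - 1 - (i : ℕ) = k - i by omega, show k - (k - (i : ℕ)) = i by omega,
        smul_mul_smul_comm, ← pow_add, Nat.sub_add_cancel hik]
    · refine (hsum y _ hyS 0 (Metric.mem_ball_self (by positivity))).of_norm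

/-- The quotient of two solutions of the same linear equation has derivative zero. -/
theorem hasDerivAt_units_inv_mul [CompleteSpace 𝔸] {U : ℂ → 𝔸ˣ} {V : ℂ → 𝔸} {C : 𝔸} {z : ℂ}
    (hU : HasDerivAt (fun w => (U w : 𝔸)) (C * U z) z) (hV : HasDerivAt V (C * V z) z) :
    HasDerivAt (fun w => ((U w)⁻¹ : 𝔸ˣ) * V w) 0 z := by
  have h1 := (hasFDerivAt_ringInverse (𝕜 := ℂ) (U z)).comp_hasDerivAt z hU
  have h2 := h1.mul hV
  refine (h2.congr_deriv ?_).congr_of_eventuallyEq (Eventually.of_forall fun w => ?_)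
  · simp [mul_assoc]
  · simp

end LinearODE

/-! ### Liouville's formula -/

section Liouville

-- The norm serves only to make matrices a Banach algebra.
open scoped Matrix.Norms.Operator

theorem Matrix.differentiable_det {n : Type*} [Fintype n] [DecidableEq n] :
    Differentiable ℂ (Matrix.det : Matrix n n ℂ → ℂ) := by
  have h (i j : n) : Differentiable ℂ fun M : Matrix n n ℂ => M i j :=
    (LinearMap.toContinuousLinearMap (Matrix.entryLinearMap ℂ ℂ i j)).differentiable
  rw [show (Matrix.det : Matrix n n ℂ → ℂ) = _ from funext Matrix.det_apply']
  fun_prop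

/-- Liouville's formula: the determinant of a fundamental solution of `Y' = C Y` solves
`y' = (tr C) y`. -/
theorem Matrix.hasDerivAt_det {n : Type*} [Fintype n] [DecidableEq n] {Y : ℂ → Matrix n n ℂ}
    {C : Matrix n n ℂ} {z : ℂ} (hY : HasDerivAt Y (C * Y z) z) (hz : IsUnit (Y z)) :
    HasDerivAt (fun w => (Y w).det) (C.trace * (Y z).det) z := by
  have hdet (N : Matrix n n ℂ) : HasFDerivAt Matrix.det (fderiv ℂ Matrix.det N) N :=
    (Matrix.differentiable_det N).hasFDerivAt
  have hone : fderiv ℂ Matrix.det (1 : Matrix n n ℂ) C = C.trace := by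
    have hline : HasDerivAt (fun r : ℂ => (1 : Matrix n n ℂ) + r • C) C 0 := by
      exact (((hasDerivAt_id (0 : ℂ)).smul_const C).const_add 1).congr_deriv (one_smul ℂ C)
    have h1 := (hdet 1).comp_hasDerivAt_of_eq (0 : ℂ) hline (by rw [zero_smul, add_zero])
    have h2 : HasDerivAt (fun r : ℂ => (1 + r • C).det) C.trace 0 := by
      set Q := (Matrix.det (1 + (Polynomial.X : Polynomial ℂ) • C.map Polynomial.C)).divX.divX
      have h3 : HasDerivAt (fun r : ℂ => 1 + C.trace * r + Q.eval r * r ^ 2) C.trace 0 := by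
        refine ((((hasDerivAt_id (0 : ℂ)).const_mul C.trace).const_add 1).add
          ((Q.hasDerivAt 0).mul ((hasDerivAt_id (0 : ℂ)).pow 2))).congr_deriv ?_
        simp
      exact h3.congr_of_eventuallyEq (Eventually.of_forall fun r => Matrix.det_one_add_smul r C)
    exact h1.unique h2
  obtain ⟨u, hu⟩ := hz
  have h4 : HasDerivAt (fun w => Y w * (u⁻¹ : (Matrix n n ℂ)ˣ)) C z := by
    have := hY.mul_const ((u⁻¹ : (Matrix n n ℂ)ˣ) : Matrix n n ℂ)
    rwa [mul_assoc, ← hu, Units.mul_inv, mul_one] at this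
  have h5 := ((hdet 1).comp_hasDerivAt_of_eq z h4 (by rw [← hu, Units.mul_inv])).congr_deriv hone
  refine (h5.mul_const (Y z).det).congr_of_eventuallyEq (Eventually.of_forall fun w => ?_)
  simp only [Function.comp_apply]
  rw [← hu, ← Matrix.det_mul, mul_assoc, Units.inv_mul, mul_one]

end Liouville

/-! ### Local parameters of the Riemann sphere -/

section LocalParam

/-- The coordinate on the sphere inverse to `localParam p` (with the junk value `0` at `∞` for a
finite `p`). -/
noncomputable def localCoord (p q : OnePoint ℂ) : ℂ :=
  match p, q with
  | none, none => 0
  | none, some z => z⁻¹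
  | some _, none => 0
  | some a, some z => z - a

/-- The finite point with local parameter `w` at `p`, for `w ≠ 0`. -/
noncomputable def finiteParam (p : OnePoint ℂ) (w : ℂ) : ℂ :=
  match p with
  | none => w⁻¹
  | some a => a + w

theorem localParam_coe (a w : ℂ) : localParam (a : OnePoint ℂ) w = ((a + w : ℂ) : OnePoint ℂ) := rfl

theorem localParam_infty_of_ne {w : ℂ} (hw : w ≠ 0) :
    localParam OnePoint.infty w = ((w⁻¹ : ℂ) : OnePoint ℂ) := if_neg hw

theorem localParam_zero (p : OnePoint ℂ) : localParam p 0 = p := by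
  induction p using OnePoint.rec with
  | infty => exact if_pos rfl
  | coe a => rw [localParam_coe, add_zero]

theorem localParam_of_ne (p : OnePoint ℂ) {w : ℂ} (hw : w ≠ 0) :
    localParam p w = (finiteParam p w : OnePoint ℂ) := by
  induction p using OnePoint.rec with
  | infty => exact localParam_infty_of_ne hw
  | coe a => rfl

theorem localCoord_coe_coe (a z : ℂ) : localCoord (a : OnePoint ℂ) (z : OnePoint ℂ) = z - a := rfl

theorem localCoord_infty_coe (z : ℂ) : localCoord OnePoint.infty (z : OnePoint ℂ) = z⁻¹ := rfl

theorem localCoord_localParam (p : OnePoint ℂ) (w : ℂ) : localCoord p (localParam p w) = w := by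
  induction p using OnePoint.rec with
  | infty =>
    rcases eq_or_ne w 0 with rfl | hw
    · rw [localParam_zero]
      rfl
    · rw [localParam_infty_of_ne hw, localCoord_infty_coe, inv_inv]
  | coe a => rw [localParam_coe, localCoord_coe_coe, add_sub_cancel_left]

theorem map_localParam_nhdsNE (p : OnePoint ℂ) : map (localParam p) (𝓝[≠] 0) = 𝓝[≠] p := by
  induction p using OnePoint.rec with
  | infty =>
    have h : localParam OnePoint.infty =ᶠ[𝓝[≠] 0] ((↑) : ℂ → OnePoint ℂ) ∘ Inv.inv := by
      filter_upwards [self_mem_nhdsWithin] with w hw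
      exact localParam_infty_of_ne hw
    rw [map_congr h, ← Filter.map_map, OnePoint.nhdsNE_infty_eq, coclosedCompact_eq_cocompact,
      ← Metric.cobounded_eq_cocompact, ← inv_nhdsNE_zero]
    rfl
  | coe a =>
    have h1 : (localParam (a : OnePoint ℂ)) = ((↑) : ℂ → OnePoint ℂ) ∘ (a + ·) := rfl
    rw [h1, ← Filter.map_map, OnePoint.nhdsWithin_coe]
    congr 1
    have h2 : (((↑) : ℂ → OnePoint ℂ) ⁻¹' {(a : OnePoint ℂ)}ᶜ) = {a}ᶜ := by
      ext z
      simp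
    rw [h2]
    simp

theorem map_localParam_nhds (p : OnePoint ℂ) : map (localParam p) (𝓝 0) = 𝓝 p := by
  rw [← nhdsNE_sup_pure (0 : ℂ), ← nhdsNE_sup_pure p, map_sup, map_localParam_nhdsNE, map_pure,
    localParam_zero]

theorem eventually_localParam {p : OnePoint ℂ} {f : OnePoint ℂ → Prop} :
    (∀ᶠ w in 𝓝 0, f (localParam p w)) ↔ ∀ᶠ q in 𝓝 p, f q := by
  rw [← map_localParam_nhds p, eventually_map]

theorem eventually_coe {a : ℂ} {f : OnePoint ℂ → Prop} :
    (∀ᶠ z : ℂ in 𝓝 a, f z) ↔ ∀ᶠ q in 𝓝 (a : OnePoint ℂ), f q := by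
  rw [OnePoint.nhds_coe_eq, eventually_map]

theorem infty_notMem_image_localParam_coe (a : ℂ) (s : Set ℂ) :
    OnePoint.infty ∉ localParam (a : OnePoint ℂ) '' s := by
  rintro ⟨w, -, hw⟩
  exact OnePoint.coe_ne_infty _ hw

end LocalParam

/-! ### Analytic germs on the sphere and their continuation -/

section Germs

variable {E : Type*} [NormedAddCommGroup E] [NormedSpace ℂ E]

/-- A vector valued function on the Riemann sphere is analytic at `p`, in terms of the local
parameter at `p`. -/
def GermAnalyticAt (Y : OnePoint ℂ → E) (p : OnePoint ℂ) : Prop :=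
  AnalyticAt ℂ (fun z => Y (localParam p z)) 0

/-- Two germs which are analytic at `p` coincide near `p`, or differ at all points near `p` other
than `p`. -/
theorem GermAnalyticAt.eventuallyEq_or_eventually_ne {Y Z : OnePoint ℂ → E} {p : OnePoint ℂ}
    (hY : GermAnalyticAt Y p) (hZ : GermAnalyticAt Z p) :
    Y =ᶠ[𝓝 p] Z ∨ ∀ᶠ q in 𝓝[≠] p, Y q ≠ Z q := by
  refine (AnalyticAt.eventually_eq_zero_or_eventually_ne_zero (AnalyticAt.sub hY hZ)).imp ?_ ?_
  · intro h
    refine eventually_localParam.mp (h.mono fun w hw => ?_)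
    exact sub_eq_zero.mp hw
  · intro h
    rw [← map_localParam_nhdsNE, eventually_map]
    exact h.mono fun w hw => sub_ne_zero.mp hw

/-- A function on the sphere which is complex differentiable near a finite point is analytic
there. -/
theorem germAnalyticAt_coe [CompleteSpace E] {Y : OnePoint ℂ → E} {a : ℂ}
    (h : ∀ᶠ z : ℂ in 𝓝 a, DifferentiableAt ℂ (fun w : ℂ => Y w) z) : GermAnalyticAt Y a := by
  have h1 : AnalyticAt ℂ (fun w : ℂ => Y w) (a + 0) := by
    rw [add_zero]
    exact Complex.analyticAt_iff_eventually_differentiableAt.mpr h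
  have h2 : AnalyticAt ℂ (fun w : ℂ => a + w) 0 := by fun_prop
  exact h1.comp (f := fun w : ℂ => a + w) h2

/-- A family of germs along `γ` is an analytic continuation, for functions with values in a normed
space. -/
structure IsGermContinuation (γ : unitInterval → OnePoint ℂ)
    (F : unitInterval → OnePoint ℂ → E) : Prop where
  analytic : ∀ s, GermAnalyticAt (F s) (γ s)
  compatible : ∀ s, ∀ᶠ s' in 𝓝 s, F s' =ᶠ[𝓝 (γ s')] F s

/-- Analytic continuation along a path is unique. -/
theorem IsGermContinuation.eventuallyEq {γ : unitInterval → OnePoint ℂ} (hγ : Continuous γ)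
    {F F' : unitInterval → OnePoint ℂ → E} (hF : IsGermContinuation γ F)
    (hF' : IsGermContinuation γ F') (h0 : F 0 =ᶠ[𝓝 (γ 0)] F' 0) (s : unitInterval) :
    F s =ᶠ[𝓝 (γ s)] F' s := by
  set S : Set unitInterval := {s | F s =ᶠ[𝓝 (γ s)] F' s} with hS
  have hopen : IsOpen S := by
    refine isOpen_iff_mem_nhds.mpr fun s hs => ?_
    filter_upwards [hF.compatible s, hF'.compatible s,
      hγ.continuousAt.eventually (Filter.Eventually.eventually_nhds hs)] with s' h1 h2 h3
    exact h1.trans (EventuallyEq.trans h3 h2.symm)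
  have hclosed : IsClosed S := by
    rw [← isOpen_compl_iff]
    refine isOpen_iff_mem_nhds.mpr fun s hs => ?_
    have hne := ((hF.analytic s).eventuallyEq_or_eventually_ne (hF'.analytic s)).resolve_left hs
    filter_upwards [hF.compatible s, hF'.compatible s,
      hγ.continuousAt.eventually (eventually_nhdsWithin_iff.mp hne).eventually_nhds]
      with s' h1 h2 h3 hs'
    have h4 : F s =ᶠ[𝓝 (γ s')] F' s := h1.symm.trans (EventuallyEq.trans hs' h2)
    -- near `γ s'` the two germs at `γ s` agree, but they differ at all points other than `γ s`
    have h5 : ∀ᶠ q in 𝓝[≠] (γ s'), q = γ s := by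
      filter_upwards [(h3.and h4).filter_mono nhdsWithin_le_nhds] with q hq
      by_contra hq'
      exact hq.1 hq' hq.2
    have h6 : ∀ᶠ q in 𝓝[≠] (γ s'), q ≠ γ s := by
      rcases eq_or_ne (γ s') (γ s) with h | h
      · rw [h]
        exact self_mem_nhdsWithin
      · exact (eventually_ne_nhds h).filter_mono nhdsWithin_le_nhds
    obtain ⟨q, hq, hq'⟩ := (h5.and h6).exists
    exact hq' hq
  have huniv : S = Set.univ := IsClopen.eq_univ ⟨hclosed, hopen⟩ ⟨0, h0⟩
  exact huniv.ge (Set.mem_univ s)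

theorem IsGermContinuation.map₂ {E' E'' : Type*} [NormedAddCommGroup E'] [NormedSpace ℂ E']
    [NormedAddCommGroup E''] [NormedSpace ℂ E''] {γ : unitInterval → OnePoint ℂ}
    {F : unitInterval → OnePoint ℂ → E} {F' : unitInterval → OnePoint ℂ → E'}
    (hF : IsGermContinuation γ F) (hF' : IsGermContinuation γ F') (φ : E → E' → E'')
    (hφ : ∀ s, GermAnalyticAt (fun q => φ (F s q) (F' s q)) (γ s)) :
    IsGermContinuation γ fun s q => φ (F s q) (F' s q) where
  analytic := hφ
  compatible s := by
    filter_upwards [hF.compatible s, hF'.compatible s] with s' h1 h2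
    filter_upwards [h1, h2] with q h3 h4
    rw [h3, h4]

theorem IsGermContinuation.map {E' : Type*} [NormedAddCommGroup E'] [NormedSpace ℂ E']
    {γ : unitInterval → OnePoint ℂ} {F : unitInterval → OnePoint ℂ → E}
    (hF : IsGermContinuation γ F) (φ : E → E')
    (hφ : ∀ s, GermAnalyticAt (fun q => φ (F s q)) (γ s)) :
    IsGermContinuation γ fun s q => φ (F s q) :=
  hF.map₂ hF (fun e _ => φ e) hφ

end Germs

/-! ### Fuchsian equations near a point of the sphere -/

section Fuchsian

variable {𝔸 : Type*} [NormedRing 𝔸] [NormedAlgebra ℂ 𝔸] {m : ℕ}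

/-- `Y` satisfies the equation `dY/dz = (∑ i, A i / (z - x i)) Y` at all finite points near `p`. -/
def SolvesNear (A : Fin m → 𝔸) (x : Fin m → ℂ) (Y : OnePoint ℂ → 𝔸) (p : OnePoint ℂ) : Prop :=
  ∀ᶠ z : ℂ in comap ((↑) : ℂ → OnePoint ℂ) (𝓝 p),
    HasDerivAt (fun w : ℂ => Y w) ((∑ i, (z - x i)⁻¹ • A i) * Y z) z

theorem solvesNear_coe {A : Fin m → 𝔸} {x : Fin m → ℂ} {Y : OnePoint ℂ → 𝔸} {a : ℂ} :
    SolvesNear A x Y a ↔ ∀ᶠ z : ℂ in 𝓝 a,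
      HasDerivAt (fun w : ℂ => Y w) ((∑ i, (z - x i)⁻¹ • A i) * Y z) z := by
  rw [SolvesNear, OnePoint.comap_coe_nhds]

theorem eventually_finiteParam {p : OnePoint ℂ} {f : ℂ → Prop}
    (h : ∀ᶠ z in comap ((↑) : ℂ → OnePoint ℂ) (𝓝 p), f z) :
    ∀ᶠ w in 𝓝[≠] (0 : ℂ), f (finiteParam p w) := by
  have h1 : ∀ᶠ q in 𝓝 p, ∀ z : ℂ, (z : OnePoint ℂ) = q → f z := eventually_comap.mp h
  filter_upwards [(eventually_localParam.mpr h1).filter_mono nhdsWithin_le_nhds,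
    self_mem_nhdsWithin] with w hw hw0
  exact hw _ (localParam_of_ne p hw0).symm

theorem differentiableAt_finiteParam (p : OnePoint ℂ) {w : ℂ} (hw : w ≠ 0) :
    DifferentiableAt ℂ (finiteParam p) w := by
  induction p using OnePoint.rec with
  | infty => exact differentiableAt_inv hw
  | coe a => exact (differentiableAt_id).const_add a

/-- Two solutions near `p` which are analytic at `p`, the first one invertible, differ by a constant
factor on the right. -/
theorem SolvesNear.eventually_eq_mul [CompleteSpace 𝔸] {A : Fin m → 𝔸} {x : Fin m → ℂ}
    {p : OnePoint ℂ} {U : OnePoint ℂ → 𝔸ˣ} {V : OnePoint ℂ → 𝔸}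
    (hU : SolvesNear A x (fun q => (U q : 𝔸)) p) (hV : SolvesNear A x V p)
    (hUa : GermAnalyticAt (fun q => (U q : 𝔸)) p) (hVa : GermAnalyticAt V p) :
    ∀ᶠ q in 𝓝 p, V q = U q * (((U p)⁻¹ : 𝔸ˣ) * V p) := by
  set f : ℂ → 𝔸 := fun w => ((U (localParam p w))⁻¹ : 𝔸ˣ) * V (localParam p w) with hf
  have hfa : AnalyticAt ℂ f 0 := by
    have h1 : AnalyticAt ℂ (fun w => Ring.inverse (U (localParam p w) : 𝔸)) 0 :=
      (analyticAt_inverse (𝕜 := ℂ) (U (localParam p 0))).comp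
        (f := fun w => (U (localParam p w) : 𝔸)) hUa
    simp only [Ring.inverse_unit] at h1
    exact h1.mul hVa
  -- the equation is only available at finite points, hence away from `0` if `p = ∞`
  have hder : ∀ᶠ w in 𝓝[≠] (0 : ℂ), deriv f w = 0 := by
    filter_upwards [eventually_finiteParam (hU.and hV), self_mem_nhdsWithin] with w hw hw0
    have h1 := HasDerivAt.scomp w (hasDerivAt_units_inv_mul (U := fun z : ℂ => U z) hw.1 hw.2)
      (differentiableAt_finiteParam p hw0).hasDerivAt
    rw [smul_zero] at h1
    have h2 : f =ᶠ[𝓝 w] (fun z : ℂ => (((U z)⁻¹ : 𝔸ˣ) : 𝔸) * V z) ∘ finiteParam p := by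
      filter_upwards [eventually_ne_nhds hw0] with v hv
      simp [hf, localParam_of_ne p hv]
    exact (h1.congr_of_eventuallyEq h2).deriv
  have hder' : ∀ᶠ w in 𝓝 (0 : ℂ), deriv f w = 0 :=
    hfa.deriv.frequently_zero_iff_eventually_zero.mp hder.frequently
  obtain ⟨ε, hε, hball⟩ := Metric.eventually_nhds_iff_ball.mp
    (hder'.and (hfa.eventually_analyticAt))
  refine eventually_localParam.mp ?_
  filter_upwards [Metric.ball_mem_nhds (0 : ℂ) hε] with w hw
  have hconst : f w = f 0 := Metric.isOpen_ball.is_const_of_deriv_eq_zero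
    (convex_ball (0 : ℂ) ε).isPreconnected
    (fun v hv => (hball v hv).2.differentiableAt.differentiableWithinAt)
    (fun v hv => (hball v hv).1) hw (Metric.mem_ball_self hε)
  have h0 : f 0 = ((U p)⁻¹ : 𝔸ˣ) * V p := by rw [hf]; simp only [localParam_zero]
  rw [← h0, ← hconst, hf]
  simp

/-- The residue at `x` of the equation, seen in the local parameter `w` at `p`: one has
`dz / (z - x) = α dw / (1 + α w)` up to a form independent of `x`, with this `α`. -/
noncomputable def chartResidue (p : OnePoint ℂ) (x : ℂ) : ℂ :=
  match p with
  | none => -x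
  | some a => (a - x)⁻¹

/-- A solution of the equation in the local parameter at `p` is a solution of the Fuchsian
equation. At `∞` this needs the residues to have sum zero. -/
theorem hasDerivAt_comp_localCoord {A : Fin m → 𝔸} {x : Fin m → ℂ} {p : OnePoint ℂ}
    (hx : ∀ i, (x i : OnePoint ℂ) ≠ p) (hA : p = OnePoint.infty → ∑ i, A i = 0) {W : ℂ → 𝔸}
    {z w : ℂ} (hz : (z : OnePoint ℂ) = localParam p w) (hzx : ∀ i, z ≠ x i)
    (hW : HasDerivAt W
      ((∑ i, (chartResidue p (x i) * (1 + chartResidue p (x i) * w)⁻¹) • A i) * W w) w) :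
    HasDerivAt (fun z : ℂ => W (localCoord p z))
      ((∑ i, (z - x i)⁻¹ • A i) * W (localCoord p z)) z := by
  have hw : localCoord p z = w := by rw [hz, localCoord_localParam]
  rw [hw]
  induction p using OnePoint.rec with
  | infty =>
    -- here `dw = -dz / z ^ 2`, and the residues at `∞` contribute `-∑ i, A i / z = 0`
    have hw0 : w ≠ 0 := by
      rintro rfl
      rw [localParam_zero] at hz
      exact OnePoint.coe_ne_infty _ hz
    rw [localCoord_infty_coe] at hw
    have hz0 : z ≠ 0 := by
      rintro rfl
      exact hw0 (by rw [← hw, inv_zero])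
    rw [← hw] at hW ⊢
    have h1 := HasDerivAt.scomp z hW (hasDerivAt_inv hz0)
    refine h1.congr_deriv ?_
    rw [← smul_mul_assoc, Finset.smul_sum]
    congr 1
    have h2 (i : Fin m) : -(z ^ 2)⁻¹ • (chartResidue OnePoint.infty (x i) *
        (1 + chartResidue OnePoint.infty (x i) * z⁻¹)⁻¹) • A i =
        (z - x i)⁻¹ • A i - z⁻¹ • A i := by
      rw [smul_smul, ← sub_smul]
      congr 1
      have h3 : z - x i ≠ 0 := sub_ne_zero.mpr (hzx i)
      have h4 : 1 + -x i * z⁻¹ = (z - x i) * z⁻¹ := by field_simp; ring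
      change -(z ^ 2)⁻¹ * (-x i * (1 + -x i * z⁻¹)⁻¹) = _
      rw [h4]
      field_simp
      ring
    rw [Finset.sum_congr rfl fun i _ => h2 i, Finset.sum_sub_distrib, ← Finset.smul_sum, hA rfl,
      smul_zero, sub_zero]
  | coe a =>
    rw [localCoord_coe_coe] at hw
    rw [← hw] at hW ⊢
    have h1 := HasDerivAt.scomp z hW ((hasDerivAt_id z).sub_const a)
    refine h1.congr_deriv ?_
    rw [one_smul]
    congr 1
    refine Finset.sum_congr rfl fun i _ => ?_
    congr 1
    have h2 : a - x i ≠ 0 := by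
      refine sub_ne_zero.mpr fun h => hx i ?_
      rw [h]
    have h3 : z - x i ≠ 0 := sub_ne_zero.mpr (hzx i)
    change (a - x i)⁻¹ * (1 + (a - x i)⁻¹ * (z - a))⁻¹ = _
    have h4 : 1 + (a - x i)⁻¹ * (z - a) = (a - x i)⁻¹ * (z - x i) := by field_simp; ring
    rw [h4, mul_inv, inv_inv, ← mul_assoc, inv_mul_cancel₀ h2, one_mul]

end Fuchsian

/-! ### Monodromy of Fuchsian equations -/

section Monodromy

variable {𝔸 : Type*} [NormedRing 𝔸] [NormedAlgebra ℂ 𝔸] [CompleteSpace 𝔸] {m : ℕ}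

/-- There is a frame at `p` with values in a group `G`: a function on the sphere which, in all the
representations `ev t : G →* 𝔸ˣ`, is an analytic invertible solution of the Fuchsian equation with
parameter `t`, on a neighbourhood of `p` that does not depend on `t`. The neighbourhood of a finite
point must not contain `∞`, so that different frames need to be compared at finite points only. -/
def HasFuchsianFrame {G T : Type*} [Group G] (ev : T → G →* 𝔸ˣ) (A : T → Fin m → 𝔸)
    (x : T → Fin m → ℂ) (p : OnePoint ℂ) : Prop :=
  ∃ U : Set (OnePoint ℂ), IsOpen U ∧ p ∈ U ∧ (OnePoint.infty ∈ U → p = OnePoint.infty) ∧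
    ∃ Φ : OnePoint ℂ → G, ∀ t, ∀ q ∈ U, GermAnalyticAt (fun q => (ev t (Φ q) : 𝔸)) q ∧
      SolvesNear (A t) (x t) (fun q => (ev t (Φ q) : 𝔸)) q

/-- Solutions of a family of Fuchsian equations which has frames at all points of `D` can be
continued along all loops of `D`, with a monodromy representation having values in the group of the
frames. -/
theorem exists_monodromy {G T : Type*} [Group G] {ev : T → G →* 𝔸ˣ}
    (hev : ∀ g h, (∀ t, ev t g = ev t h) → g = h) {A : T → Fin m → 𝔸} {x : T → Fin m → ℂ}
    {D : Set (OnePoint ℂ)} (hframe : ∀ p ∈ D, HasFuchsianFrame ev A x p) (x₀ : D) :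
    ∃ (Φ : OnePoint ℂ → G) (hol : FundamentalGroup D x₀ →* G),
      (∀ t, GermAnalyticAt (fun q => (ev t (Φ q) : 𝔸)) x₀ ∧
        SolvesNear (A t) (x t) (fun q => (ev t (Φ q) : 𝔸)) x₀) ∧
      ∀ (γ : Path x₀ x₀) (t : T), ∃ F : unitInterval → OnePoint ℂ → 𝔸ˣ,
        IsGermContinuation (fun s => (γ s : OnePoint ℂ)) (fun s q => (F s q : 𝔸)) ∧
        (∀ q, F 0 q = ev t (Φ q)) ∧
        ∀ q, F 1 q = ev t (Φ q) *
          ev t (hol (FundamentalGroup.fromPath (Path.Homotopic.Quotient.mk γ))) := by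
  choose U hUo hpU hUinf Φ hΦ using fun p : D => hframe p p.2
  have hconst (p q : D) (y : OnePoint ℂ) (hp : y ∈ U p) (hq : y ∈ U q) :
      ∀ᶠ z in 𝓝 y, (Φ q z)⁻¹ * Φ p z = (Φ q y)⁻¹ * Φ p y := by
    induction y using OnePoint.rec with
    | infty =>
      -- only the frame at `∞` is defined at `∞`
      have hpq : p = q := Subtype.ext ((hUinf p hp).trans (hUinf q hq).symm)
      refine Eventually.of_forall fun z => ?_
      rw [hpq, inv_mul_cancel, inv_mul_cancel]
    | coe a =>
      obtain ⟨ε, hε, hball⟩ := Metric.eventually_nhds_iff_ball.mp (eventually_coe.mpr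
        (((hUo p).inter (hUo q)).eventually_mem ⟨hp, hq⟩))
      rw [← eventually_coe]
      filter_upwards [Metric.ball_mem_nhds a hε] with z hz
      refine hev _ _ fun t => Units.ext ?_
      have hder (v : ℂ) (hv : v ∈ Metric.ball a ε) : HasDerivAt
          (fun v : ℂ => (((ev t (Φ q v))⁻¹ : 𝔸ˣ) : 𝔸) * ev t (Φ p v)) 0 v := by
        obtain ⟨h1, h2⟩ := hball v hv
        exact hasDerivAt_units_inv_mul (U := fun v : ℂ => ev t (Φ q v))
          (solvesNear_coe.mp (hΦ q t v h2).2).self_of_nhds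
          (solvesNear_coe.mp (hΦ p t v h1).2).self_of_nhds
      have := Metric.isOpen_ball.is_const_of_deriv_eq_zero (convex_ball a ε).isPreconnected
        (fun v hv => (hder v hv).differentiableAt.differentiableWithinAt)
        (fun v hv => (hder v hv).deriv) hz (Metric.mem_ball_self hε)
      simpa only [map_mul, map_inv, Units.val_mul] using this
  let L : FlatFrames D G :=
    { dom := fun p => Subtype.val ⁻¹' U p
      isOpen_dom := fun p => (hUo p).preimage continuous_subtype_val
      mem_dom := hpU
      frame := fun p q => Φ p q
      locallyConst := fun p q y hp hq =>
        continuous_subtype_val.continuousAt.eventually (hconst p q y hp hq) }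
  obtain ⟨hol, hhol⟩ := L.exists_holonomy x₀
  refine ⟨Φ x₀, hol, fun t => hΦ x₀ t x₀ (hpU x₀), fun γ t => ?_⟩
  obtain ⟨g, hg, hg0, hg1⟩ := hhol γ
  refine ⟨fun s q => ev t (Φ (γ s) q * g s), ⟨fun s => ?_, fun s => ?_⟩, fun q => ?_, fun q => ?_⟩
  · simp only [map_mul, Units.val_mul]
    exact AnalyticAt.mul (hΦ (γ s) t (γ s) (hpU _)).1 analyticAt_const
  · have hdom : ∀ᶠ s' in 𝓝 s, (γ s' : OnePoint ℂ) ∈ U (γ s) :=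
      (continuous_subtype_val.comp γ.continuous).continuousAt.eventually
        ((hUo (γ s)).eventually_mem (hpU (γ s)))
    filter_upwards [hg s, hdom] with s' h1 h2
    filter_upwards [hconst (γ s) (γ s') (γ s') h2 (hpU _)] with q hq
    have h3 : Φ (γ s') (γ s') * g s' = Φ (γ s) (γ s') * g s := h1
    congr 2
    have h4 : g s' = (Φ (γ s') (γ s'))⁻¹ * Φ (γ s) (γ s') * g s := by
      rw [mul_assoc, ← h3, inv_mul_cancel_left]
    rw [h4, ← hq]
    group
  · beta_reduce
    rw [hg0, mul_one, γ.source]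
  · beta_reduce
    rw [hg1, map_mul, γ.target]

theorem mem_interior_image_localParam {p : OnePoint ℂ} {r : ℝ} (hr : 0 < r) :
    p ∈ interior (localParam p '' Metric.ball 0 r) := by
  rw [mem_interior_iff_mem_nhds, ← map_localParam_nhds]
  exact image_mem_map (Metric.ball_mem_nhds 0 hr)

/-- A solution of the equation in the local parameter at `p` is analytic, and solves the Fuchsian
equation, on the corresponding disk of the sphere. -/
theorem germAnalyticAt_and_solvesNear_of_chart {A : Fin m → 𝔸} {x : Fin m → ℂ} {p : OnePoint ℂ}
    {r : ℝ} (hx : ∀ i, ∀ w ∈ Metric.ball 0 r, localParam p w ≠ x i)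
    (hA : p = OnePoint.infty → ∑ i, A i = 0) {W : ℂ → 𝔸}
    (hW : ∀ w ∈ Metric.ball (0 : ℂ) r, HasDerivAt W
      ((∑ i, (chartResidue p (x i) * (1 + chartResidue p (x i) * w)⁻¹) • A i) * W w) w)
    {q : OnePoint ℂ} (hq : q ∈ interior (localParam p '' Metric.ball 0 r)) :
    GermAnalyticAt (fun q => W (localCoord p q)) q ∧
      SolvesNear A x (fun q => W (localCoord p q)) q := by
  have hr : 0 < r := by
    obtain ⟨w, hw, -⟩ := interior_subset hq
    exact Metric.pos_of_mem_ball hw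
  have hp (i : Fin m) : (x i : OnePoint ℂ) ≠ p := by
    have := hx i 0 (Metric.mem_ball_self hr)
    rw [localParam_zero] at this
    exact this.symm
  have hder (z : ℂ) (hz : (z : OnePoint ℂ) ∈ interior (localParam p '' Metric.ball 0 r)) :
      HasDerivAt (fun z : ℂ => W (localCoord p z))
        ((∑ i, (z - x i)⁻¹ • A i) * W (localCoord p z)) z := by
    obtain ⟨w, hw, hwz⟩ := interior_subset hz
    refine hasDerivAt_comp_localCoord hp hA hwz.symm (fun i h => hx i w hw ?_) (hW w hw)
    rw [hwz, h]
  have hnear := isOpen_interior.eventually_mem hq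
  refine ⟨?_, ?_⟩
  · induction q using OnePoint.rec with
    | infty =>
      have hpinf : p = OnePoint.infty := by
        induction p using OnePoint.rec with
        | infty => rfl
        | coe a => exact absurd (interior_subset hq) (infty_notMem_image_localParam_coe a _)
      subst hpinf
      rw [GermAnalyticAt]
      simp only [localCoord_localParam]
      rw [Complex.analyticAt_iff_eventually_differentiableAt]
      filter_upwards [Metric.ball_mem_nhds (0 : ℂ) hr] with w hw
      exact (hW w hw).differentiableAt
    | coe a =>
      refine germAnalyticAt_coe ?_
      filter_upwards [eventually_coe.mpr hnear] with z hz
      exact (hder z hz).differentiableAt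
  · filter_upwards [preimage_mem_comap hnear] with z hz
    exact hder z hz

/-- A disk of the local parameter at `p` which avoids `x` bounds the residue of the equation. -/
theorem norm_chartResidue_mul_lt_one {p : OnePoint ℂ} {x : ℂ} {r : ℝ}
    (hx : ∀ w ∈ Metric.ball 0 r, localParam p w ≠ x) {w : ℂ} (hw : w ∈ Metric.ball (0 : ℂ) r) :
    ‖chartResidue p x * w‖ < 1 := by
  rcases eq_or_ne (chartResidue p x) 0 with h0 | h0
  · simp [h0]
  -- the point `x` has the local parameter `-α⁻¹`, where `α` is the residue
  have h1 : localParam p (-(chartResidue p x)⁻¹) = x := by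
    induction p using OnePoint.rec with
    | infty =>
      rw [localParam_infty_of_ne (by simpa using h0), inv_neg, inv_inv]
      change ((- -x : ℂ) : OnePoint ℂ) = _
      rw [neg_neg]
    | coe a =>
      rw [localParam_coe]
      change ((a + -((a - x)⁻¹)⁻¹ : ℂ) : OnePoint ℂ) = _
      rw [inv_inv]
      congr 1
      ring
  have h2 : -(chartResidue p x)⁻¹ ∉ Metric.ball (0 : ℂ) r := fun h => hx _ h h1
  rw [mem_ball_zero_iff, norm_neg, norm_inv, not_lt] at h2
  rw [mem_ball_zero_iff] at hw
  rw [norm_mul]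
  calc ‖chartResidue p x‖ * ‖w‖ < ‖chartResidue p x‖ * ‖chartResidue p x‖⁻¹ :=
        mul_lt_mul_of_pos_left (hw.trans_le h2) (norm_pos_iff.mpr h0)
    _ = 1 := mul_inv_cancel₀ (norm_ne_zero_iff.mpr h0)

/-- A Fuchsian equation has local fundamental solutions at the points of its domain. -/
theorem hasFuchsianFrame_of_isOpen {A : Fin m → 𝔸} {x : Fin m → ℂ} {D : Set (OnePoint ℂ)}
    (hD : IsOpen D) (hx : ∀ i, (x i : OnePoint ℂ) ∉ D)
    (hA : OnePoint.infty ∈ D → ∑ i, A i = 0) {p : OnePoint ℂ} (hp : p ∈ D) :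
    HasFuchsianFrame (fun _ : Unit => MonoidHom.id 𝔸ˣ) (fun _ => A) (fun _ => x) p := by
  classical
  set α : Fin m → ℂ := fun i => chartResidue p (x i) with hα
  set R : ℝ := ∑ i, ‖α i‖ with hR
  set c : ℕ → 𝔸 := fun k => ∑ i, (α i * (-α i) ^ k) • A i with hc
  have hR0 : 0 ≤ R := Finset.sum_nonneg fun i _ => norm_nonneg _
  have hcle (k : ℕ) : ‖c k‖ ≤ (∑ i, ‖α i‖ * ‖A i‖) * R ^ k := by
    rw [hc, Finset.sum_mul]
    refine norm_sum_le_of_le _ fun i _ => ?_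
    rw [norm_smul, norm_mul, norm_pow, norm_neg, mul_right_comm]
    gcongr
    exact Finset.single_le_sum (f := fun i => ‖α i‖) (fun i _ => norm_nonneg _) (Finset.mem_univ i)
  obtain ⟨r, hr, W, hW0, hW⟩ := exists_linearODE_solution
    (Finset.sum_nonneg fun i _ => by positivity) hR0 hcle
  have hunit : ∀ᶠ w in 𝓝 (0 : ℂ), IsUnit (W w) := by
    have h1 : ContinuousAt W 0 := (hW 0 (Metric.mem_ball_self hr)).continuousAt
    refine h1.eventually (Units.isOpen.eventually_mem ?_)
    rw [hW0]
    exact isUnit_one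
  have hDnear : ∀ᶠ w in 𝓝 (0 : ℂ), localParam p w ∈ D :=
    eventually_localParam.mpr (hD.eventually_mem hp)
  obtain ⟨ε, hε, hball⟩ := Metric.eventually_nhds_iff_ball.mp
    ((hunit.and hDnear).and (Metric.ball_mem_nhds (0 : ℂ) hr))
  have hxball (i : Fin m) (w : ℂ) (hw : w ∈ Metric.ball 0 ε) : localParam p w ≠ x i :=
    fun h => hx i (h ▸ (hball w hw).1.2)
  have hcoeff (w : ℂ) (hw : w ∈ Metric.ball (0 : ℂ) ε) :
      ∑' k, w ^ k • c k = ∑ i, (α i * (1 + α i * w)⁻¹) • A i := by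
    have h1 (i : Fin m) : HasSum (fun k : ℕ => w ^ k • ((α i * (-α i) ^ k) • A i))
        ((α i * (1 + α i * w)⁻¹) • A i) := by
      have h2 : ‖-(α i * w)‖ < 1 := by
        rw [norm_neg]
        exact norm_chartResidue_mul_lt_one (hxball i) hw
      have h3 := ((hasSum_geometric_of_norm_lt_one h2).mul_left (α i)).smul_const (A i)
      rw [sub_neg_eq_add] at h3
      refine h3.congr_fun fun k => ?_
      rw [smul_smul, ← neg_mul, mul_pow]
      congr 1
      ring
    simp only [hc, Finset.smul_sum]
    exact (hasSum_sum fun i _ => h1 i).tsum_eq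
  let V : ℂ → 𝔸ˣ := fun w => if h : IsUnit (W w) then h.unit else 1
  have hV (w : ℂ) (hw : w ∈ Metric.ball (0 : ℂ) ε) : (V w : 𝔸) = W w := by
    simp only [V, dif_pos (hball w hw).1.1, IsUnit.unit_spec]
  refine ⟨interior (localParam p '' Metric.ball 0 ε), isOpen_interior,
    mem_interior_image_localParam hε, ?_, fun q => V (localCoord p q), fun _ q hq => ?_⟩
  · intro h
    induction p using OnePoint.rec with
    | infty => rfl
    | coe a => exact absurd (interior_subset h) (infty_notMem_image_localParam_coe a _)
  · refine germAnalyticAt_and_solvesNear_of_chart (W := fun w => (V w : 𝔸)) hxball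
      (fun h => hA (h ▸ hp)) (fun w hw => ?_) hq
    have h1 := hW w (hball w hw).2
    rw [hcoeff w hw] at h1
    rw [hV w hw]
    refine h1.congr_of_eventuallyEq ?_
    filter_upwards [Metric.isOpen_ball.eventually_mem hw] with v hv
    exact hV v hv

end Monodromy

/-! ### Scalar Fuchsian equations depending on a parameter -/

section Scalar

variable {r : ℕ}

/-- The group of nowhere vanishing analytic functions on `P`. -/
def analyticUnits (P : Set (Fin r → ℂ)) : Subgroup (P → ℂˣ) where
  carrier := {f | ∃ g : (Fin r → ℂ) → ℂ, AnalyticOnNhd ℂ g P ∧ ∀ t : P, (f t : ℂ) = g t}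
  mul_mem' := by
    rintro f f' ⟨g, hg, hfg⟩ ⟨g', hg', hfg'⟩
    exact ⟨g * g', hg.mul hg', fun t => by simp [hfg, hfg']⟩
  one_mem' := ⟨1, analyticOnNhd_const, fun t => rfl⟩
  inv_mem' := by
    rintro f ⟨g, hg, hfg⟩
    refine ⟨g⁻¹, hg.inv fun t ht => ?_, fun t => by simp [hfg]⟩
    rw [← hfg ⟨t, ht⟩]
    exact Units.ne_zero _

/-- Evaluation of nowhere vanishing analytic functions at a point of `P`. -/
def analyticUnitsEval (P : Set (Fin r → ℂ)) (t : P) : analyticUnits P →* ℂˣ :=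
  (Pi.evalMonoidHom (fun _ : P => ℂˣ) t).comp (analyticUnits P).subtype

/-- Scalar Fuchsian equations whose data depend analytically on a parameter have the solutions
`∏ i, (1 + α i * w) ^ b i` in the local parameter `w`, which depend analytically on the
parameter. -/
theorem hasFuchsianFrame_analyticUnits {m : ℕ} {P : Set (Fin r → ℂ)}
    {b x : Fin m → (Fin r → ℂ) → ℂ}
    (hb : ∀ i, AnalyticOnNhd ℂ (b i) P) (hx : ∀ i, AnalyticOnNhd ℂ (x i) P)
    {D : Set (OnePoint ℂ)} (hD : IsOpen D) (hxD : ∀ i, ∀ t ∈ P, (x i t : OnePoint ℂ) ∉ D)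
    (hbinf : OnePoint.infty ∈ D → ∀ t ∈ P, ∑ i, b i t = 0) {p : OnePoint ℂ} (hp : p ∈ D) :
    HasFuchsianFrame (analyticUnitsEval P) (fun t i => b i t) (fun t i => x i t) p := by
  classical
  obtain ⟨ε, hε, hball⟩ := Metric.eventually_nhds_iff_ball.mp
    (eventually_localParam.mpr (hD.eventually_mem hp))
  have hxball (t : P) (i : Fin m) (w : ℂ) (hw : w ∈ Metric.ball 0 ε) : localParam p w ≠ x i t :=
    fun h => hxD i t t.2 (h ▸ hball w hw)
  have hslit (t : P) (i : Fin m) (w : ℂ) (hw : w ∈ Metric.ball 0 ε) :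
      1 + chartResidue p (x i t) * w ∈ Complex.slitPlane :=
    Complex.mem_slitPlane_of_norm_lt_one (norm_chartResidue_mul_lt_one (hxball t i) hw)
  have hα (i : Fin m) : AnalyticOnNhd ℂ (fun t => chartResidue p (x i t)) P := by
    induction p using OnePoint.rec with
    | infty => exact (hx i).neg
    | coe a =>
      refine (analyticOnNhd_const.sub (hx i)).inv fun t ht => ?_
      have := hxball ⟨t, ht⟩ i 0 (Metric.mem_ball_self hε)
      rw [localParam_zero] at this
      exact sub_ne_zero.mpr fun h => this (congrArg _ h)
  let φ : ℂ → (Fin r → ℂ) → ℂ := fun w t =>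
    Complex.exp (∑ i, Complex.log (1 + chartResidue p (x i t) * w) * b i t)
  have hφ (w : ℂ) (hw : w ∈ Metric.ball 0 ε) : AnalyticOnNhd ℂ (φ w) P := fun t ht =>
    (Finset.analyticAt_fun_sum _ fun i _ =>
      (((analyticAt_const.add ((hα i t ht).mul analyticAt_const))).clog
        (hslit ⟨t, ht⟩ i w hw)).mul (hb i t ht)).cexp
  let V : ℂ → analyticUnits P := fun w =>
    if hw : w ∈ Metric.ball (0 : ℂ) ε then
      ⟨fun t => Units.mk0 (φ w t) (Complex.exp_ne_zero _), φ w, hφ w hw, fun _ => rfl⟩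
    else 1
  have hV (t : P) (w : ℂ) (hw : w ∈ Metric.ball (0 : ℂ) ε) :
      (analyticUnitsEval P t (V w) : ℂ) = φ w t := by
    simp only [V, dif_pos hw]
    rfl
  refine ⟨interior (localParam p '' Metric.ball 0 ε), isOpen_interior,
    mem_interior_image_localParam hε, ?_, fun q => V (localCoord p q), fun t q hq => ?_⟩
  · intro h
    induction p using OnePoint.rec with
    | infty => rfl
    | coe a => exact absurd (interior_subset h) (infty_notMem_image_localParam_coe a _)
  · refine germAnalyticAt_and_solvesNear_of_chart
      (W := fun w => (analyticUnitsEval P t (V w) : ℂ)) (hxball t)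
      (fun h => hbinf (h ▸ hp) t t.2) (fun w hw => ?_) hq
    rw [hV t w hw]
    have h1 : HasDerivAt (fun w => φ w t) ((∑ i, (chartResidue p (x i t) *
        (1 + chartResidue p (x i t) * w)⁻¹) • b i t) * φ w t) w := by
      have h2 (i : Fin m) : HasDerivAt
          (fun w => Complex.log (1 + chartResidue p (x i t) * w) * b i t)
          ((chartResidue p (x i t) * (1 + chartResidue p (x i t) * w)⁻¹) • b i t) w := by
        have h3 : HasDerivAt (fun w => 1 + chartResidue p (x i t) * w)
            (chartResidue p (x i t)) w := by
          simpa using ((hasDerivAt_id w).const_mul (chartResidue p (x i t))).const_add 1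
        exact (h3.clog (hslit t i w hw)).mul_const (b i t)
      refine (HasDerivAt.fun_sum fun i _ => h2 i).cexp.congr_deriv (mul_comm _ _)
    refine h1.congr_of_eventuallyEq ?_
    filter_upwards [Metric.isOpen_ball.eventually_mem hw] with v hv
    exact hV t v hv

end Scalar

/-! ### Matrix valued solutions -/

section Matrices

open scoped Matrix.Norms.Operator

variable {m n : ℕ}

theorem analyticAt_matrix_iff {Y : ℂ → Matrix (Fin n) (Fin n) ℂ} {z : ℂ} :
    AnalyticAt ℂ Y z ↔ ∀ k l, AnalyticAt ℂ (fun w => Y w k l) z := by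
  constructor
  · intro h k l
    exact ((LinearMap.toContinuousLinearMap (Matrix.entryLinearMap ℂ ℂ k l)).analyticAt _).comp h
  · intro h
    have hY : Y = fun w => ∑ k, ∑ l, Y w k l • Matrix.single k l (1 : ℂ) := by
      funext w
      conv_lhs => rw [Matrix.matrix_eq_sum_single (Y w)]
      simp
    rw [hY]
    exact Finset.analyticAt_fun_sum _ fun k _ => Finset.analyticAt_fun_sum _ fun l _ =>
      (h k l).smul analyticAt_const

theorem hasDerivAt_matrix_iff {Y : ℂ → Matrix (Fin n) (Fin n) ℂ} {Y' : Matrix (Fin n) (Fin n) ℂ}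
    {z : ℂ} : HasDerivAt Y Y' z ↔ ∀ k l, HasDerivAt (fun w => Y w k l) (Y' k l) z := by
  constructor
  · intro h k l
    exact (LinearMap.toContinuousLinearMap
      (Matrix.entryLinearMap ℂ ℂ k l)).hasFDerivAt.comp_hasDerivAt z h
  · intro h
    have hsum (M : Matrix (Fin n) (Fin n) ℂ) :
        M = ∑ k, ∑ l, M k l • Matrix.single k l (1 : ℂ) := by
      conv_lhs => rw [Matrix.matrix_eq_sum_single M]
      simp
    rw [hsum Y', show Y = _ from funext fun w => hsum (Y w)]
    exact HasDerivAt.fun_sum fun k _ => HasDerivAt.fun_sum fun l _ => (h k l).smul_const _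

theorem matrixAnalyticAt_iff {Y : OnePoint ℂ → Matrix (Fin n) (Fin n) ℂ} {p : OnePoint ℂ} :
    MatrixAnalyticAt Y p ↔ GermAnalyticAt Y p :=
  analyticAt_matrix_iff.symm

theorem isLocalFundamentalSolution_iff {A : Fin m → Matrix (Fin n) (Fin n) ℂ} {x : Fin m → ℂ}
    {p : OnePoint ℂ} {Y : OnePoint ℂ → Matrix (Fin n) (Fin n) ℂ} :
    IsLocalFundamentalSolution A x p Y ↔
      GermAnalyticAt Y p ∧ IsUnit (Y p) ∧ SolvesNear A x Y p := by
  have h : SolvesNear A x Y p ↔ ∀ᶠ z : ℂ in comap ((↑) : ℂ → OnePoint ℂ) (𝓝 p), ∀ k l,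
      HasDerivAt (fun w : ℂ => Y (w : OnePoint ℂ) k l)
        ((fuchsianCoeff A x z * Y (z : OnePoint ℂ)) k l) z :=
    eventually_congr (Eventually.of_forall fun z => hasDerivAt_matrix_iff)
  rw [h, ← matrixAnalyticAt_iff]
  exact ⟨fun h => ⟨h.1, h.2, h.3⟩, fun h => ⟨h.1, h.2.1, h.2.2⟩⟩

theorem isAnalyticContinuation_iff {γ : unitInterval → OnePoint ℂ}
    {F : unitInterval → OnePoint ℂ → Matrix (Fin n) (Fin n) ℂ} :
    IsAnalyticContinuation γ F ↔ IsGermContinuation γ F :=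
  ⟨fun h => ⟨fun s => matrixAnalyticAt_iff.mp (h.1 s), h.2⟩,
    fun h => ⟨fun s => matrixAnalyticAt_iff.mpr (h.1 s), h.2⟩⟩

theorem GermAnalyticAt.eventually_isUnit {Y : OnePoint ℂ → Matrix (Fin n) (Fin n) ℂ}
    {p : OnePoint ℂ} (hY : GermAnalyticAt Y p) (hp : IsUnit (Y p)) : ∀ᶠ q in 𝓝 p, IsUnit (Y q) := by
  refine eventually_localParam.mp (hY.continuousAt.eventually (Units.isOpen.eventually_mem ?_))
  simpa only [localParam_zero, Set.mem_ofPred_eq] using hp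

theorem GermAnalyticAt.det {Y : OnePoint ℂ → Matrix (Fin n) (Fin n) ℂ} {p : OnePoint ℂ}
    (hY : GermAnalyticAt Y p) : GermAnalyticAt (fun q => (Y q).det) p := by
  refine Complex.analyticAt_iff_eventually_differentiableAt.mpr ?_
  filter_upwards [Complex.analyticAt_iff_eventually_differentiableAt.mp hY] with w hw
  exact (Matrix.differentiable_det _).comp w hw

theorem SolvesNear.det {A : Fin m → Matrix (Fin n) (Fin n) ℂ} {x : Fin m → ℂ} {p : OnePoint ℂ}
    {Y : OnePoint ℂ → Matrix (Fin n) (Fin n) ℂ} (hY : SolvesNear A x Y p)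
    (hp : ∀ᶠ q in 𝓝 p, IsUnit (Y q)) :
    SolvesNear (fun i => (A i).trace) x (fun q => (Y q).det) p := by
  filter_upwards [hY, preimage_mem_comap hp] with z hz hz'
  refine (Matrix.hasDerivAt_det hz hz').congr_deriv ?_
  simp [Matrix.trace_sum, Matrix.trace_smul]

/-- Twisting a solution by a solution of a scalar equation adds scalar matrices to the residues. -/
theorem SolvesNear.smul {b : Fin m → ℂ} {B : Fin m → Matrix (Fin n) (Fin n) ℂ} {x : Fin m → ℂ}
    {p : OnePoint ℂ} {y : OnePoint ℂ → ℂ} {Y : OnePoint ℂ → Matrix (Fin n) (Fin n) ℂ}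
    (hy : SolvesNear b x y p) (hY : SolvesNear B x Y p) :
    SolvesNear (fun i => B i + b i • (1 : Matrix (Fin n) (Fin n) ℂ)) x (fun q => y q • Y q) p := by
  filter_upwards [hy, hY] with z h1 h2
  refine (HasDerivAt.fun_smul h1 h2).congr_deriv ?_
  simp only [smul_add, Finset.sum_add_distrib, add_mul, smul_smul, ← Finset.sum_smul,
    smul_mul_assoc, one_mul, mul_smul_comm, smul_eq_mul]
  rw [mul_comm (y _)]

theorem SolvesNear.inv {b : Fin m → ℂ} {x : Fin m → ℂ} {p : OnePoint ℂ} {y : OnePoint ℂ → ℂˣ}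
    (hy : SolvesNear b x (fun q => (y q : ℂ)) p) :
    SolvesNear (fun i => -b i) x (fun q => (y q : ℂ)⁻¹) p := by
  filter_upwards [hy] with z h1
  refine (h1.fun_inv (y z).ne_zero).congr_deriv ?_
  have := (y z).ne_zero
  simp only [smul_neg, Finset.sum_neg_distrib]
  field_simp

end Matrices

/-! ### Isomonodromy and projective isomonodromy -/

section Isomonodromy

open scoped Matrix.Norms.Operator

variable {m n r : ℕ} {D : Set (OnePoint ℂ)} {x₀ : D}

theorem continuous_coe_path (γ : Path x₀ x₀) : Continuous fun s => (γ s : OnePoint ℂ) :=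
  continuous_subtype_val.comp γ.continuous

/-- A germ of fundamental solution has at most one monodromy matrix along a loop. -/
theorem ContinuesTo.monodromy_unique {γ : Path x₀ x₀}
    {Y : OnePoint ℂ → Matrix (Fin n) (Fin n) ℂ} (hY : IsUnit (Y x₀))
    {M N : Matrix (Fin n) (Fin n) ℂ} (hM : ContinuesTo γ Y fun p => Y p * M)
    (hN : ContinuesTo γ Y fun p => Y p * N) : M = N := by
  obtain ⟨F, hF, hF0, hF1⟩ := hM
  obtain ⟨F', hF', hF0', hF1'⟩ := hN
  have h := IsGermContinuation.eventuallyEq (continuous_coe_path γ)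
    (isAnalyticContinuation_iff.mp hF) (isAnalyticContinuation_iff.mp hF')
    (by rw [γ.source]; exact hF0.trans hF0'.symm) 1
  rw [γ.target] at h
  have h1 := (hF1.symm.trans (h.trans hF1')).self_of_nhds
  exact hY.mul_left_cancel h1

/-- Every local fundamental solution has a monodromy representation. -/
theorem IsLocalFundamentalSolution.exists_monodromy {A : Fin m → Matrix (Fin n) (Fin n) ℂ}
    {x : Fin m → ℂ} (hD : IsOpen D) (hx : ∀ i, (x i : OnePoint ℂ) ∉ D)
    (hA : OnePoint.infty ∈ D → ∑ i, A i = 0) {Y : OnePoint ℂ → Matrix (Fin n) (Fin n) ℂ}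
    (hY : IsLocalFundamentalSolution A x x₀ Y) :
    ∃ ρ : FundamentalGroup D x₀ →* GL (Fin n) ℂ, ∀ γ : Path x₀ x₀, ContinuesTo γ Y fun p =>
      Y p * (ρ (FundamentalGroup.fromPath (Path.Homotopic.Quotient.mk γ)) :
        Matrix (Fin n) (Fin n) ℂ) := by
  obtain ⟨Φ, hol, hΦ, hcont⟩ := _root_.exists_monodromy
    (ev := fun _ : Unit => MonoidHom.id (Matrix (Fin n) (Fin n) ℂ)ˣ)
    (fun g h hgh => hgh ()) (fun p hp => hasFuchsianFrame_of_isOpen hD hx hA hp) x₀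
  obtain ⟨hYa, hYu, hYs⟩ := isLocalFundamentalSolution_iff.mp hY
  obtain ⟨u, hu⟩ := hYu
  set C : GL (Fin n) ℂ := (Φ x₀)⁻¹ * u with hC
  have hYΦ : ∀ᶠ q in 𝓝 (x₀ : OnePoint ℂ), Y q = Φ q * C := by
    have := SolvesNear.eventually_eq_mul (hΦ ()).2 hYs (hΦ ()).1 hYa
    rw [← hu] at this
    exact this
  refine ⟨(MulAut.conj C⁻¹).toMonoidHom.comp hol, fun γ => ?_⟩
  obtain ⟨F, hF, hF0, hF1⟩ := hcont γ ()
  refine ⟨fun s q => (F s q : Matrix (Fin n) (Fin n) ℂ) * C, isAnalyticContinuation_iff.mpr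
    (hF.map (fun M => M * (C : Matrix (Fin n) (Fin n) ℂ)) fun s =>
      AnalyticAt.mul (hF.analytic s) analyticAt_const), ?_, ?_⟩
  · filter_upwards [hYΦ] with q hq
    rw [hq, hF0]
    rfl
  · filter_upwards [hYΦ] with q hq
    rw [hq, hF1]
    simp only [MonoidHom.id_apply, MonoidHom.comp_apply, MulEquiv.coe_toMonoidHom,
      MulAut.conj_apply, ← Units.val_mul]
    congr 1
    group

/-- If suitable local fundamental solutions have constant monodromy along generators of the
fundamental group, then the system is isomonodromic. -/
theorem isIsomonodromic_of_generators {P : Set (Fin r → ℂ)} (hP : P.Nonempty) (hD : IsOpen D)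
    {γ : Fin m → Path x₀ x₀}
    (hγ : Subgroup.closure (Set.range fun i =>
      FundamentalGroup.fromPath (Path.Homotopic.Quotient.mk (γ i))) = ⊤)
    {B : Fin m → (Fin r → ℂ) → Matrix (Fin n) (Fin n) ℂ} {x : Fin m → (Fin r → ℂ) → ℂ}
    (hx : ∀ i, ∀ t ∈ P, (x i t : OnePoint ℂ) ∉ D)
    (hB : OnePoint.infty ∈ D → ∀ t ∈ P, ∑ i, B i t = 0)
    {H : Fin m → Matrix (Fin n) (Fin n) ℂ}
    (h : ∀ t ∈ P, ∃ Y : OnePoint ℂ → Matrix (Fin n) (Fin n) ℂ,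
      IsLocalFundamentalSolution (fun i => B i t) (fun i => x i t) x₀ Y ∧
      ∀ i, ContinuesTo (γ i) Y fun p => Y p * H i) :
    IsIsomonodromic P x₀ B x := by
  choose! Y hY hYγ using h
  have hρ (t : P) := (hY t t.2).exists_monodromy hD (fun i => hx i t t.2) fun hinf => hB hinf t t.2
  choose ρ hρ using hρ
  obtain ⟨t₀, ht₀⟩ := hP
  have hρeq (t : P) : ρ t = ρ ⟨t₀, ht₀⟩ := by
    refine MonoidHom.eq_of_eqOn_dense hγ ?_
    rintro _ ⟨i, rfl⟩
    refine Units.ext ?_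
    rw [(hρ t (γ i)).monodromy_unique (hY t t.2).invertible (hYγ t t.2 i),
      (hρ ⟨t₀, ht₀⟩ (γ i)).monodromy_unique (hY t₀ ht₀).invertible (hYγ t₀ ht₀ i)]
  refine ⟨fun γ' => ρ ⟨t₀, ht₀⟩ (FundamentalGroup.fromPath (Path.Homotopic.Quotient.mk γ')),
    fun t ht => ⟨Y t, hY t ht, fun γ' => ?_⟩⟩
  rw [← hρeq ⟨t, ht⟩]
  exact hρ ⟨t, ht⟩ γ'

/-- A scalar Fuchsian equation has local solutions whose monodromy along each loop is an analytic
nowhere vanishing function of the parameter. -/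
theorem exists_scalar_monodromy {P : Set (Fin r → ℂ)} (hD : IsOpen D) (x₀ : D)
    {b x : Fin m → (Fin r → ℂ) → ℂ}
    (hb : ∀ i, AnalyticOnNhd ℂ (b i) P) (hx : ∀ i, AnalyticOnNhd ℂ (x i) P)
    (hxD : ∀ i, ∀ t ∈ P, (x i t : OnePoint ℂ) ∉ D)
    (hbinf : OnePoint.infty ∈ D → ∀ t ∈ P, ∑ i, b i t = 0) :
    ∃ (y : (Fin r → ℂ) → OnePoint ℂ → ℂˣ) (d : Path x₀ x₀ → (Fin r → ℂ) → ℂ),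
      (∀ γ, AnalyticOnNhd ℂ (d γ) P) ∧ ∀ t ∈ P,
        GermAnalyticAt (fun q => (y t q : ℂ)) x₀ ∧
        SolvesNear (fun i => b i t) (fun i => x i t) (fun q => (y t q : ℂ)) x₀ ∧
        ∀ γ, d γ t ≠ 0 ∧ ∃ F : unitInterval → OnePoint ℂ → ℂˣ,
          IsGermContinuation (fun s => (γ s : OnePoint ℂ)) (fun s q => (F s q : ℂ)) ∧
          (∀ q, F 0 q = y t q) ∧ ∀ q, (F 1 q : ℂ) = y t q * d γ t := by
  classical
  obtain ⟨Φ, hol, hΦ, hcont⟩ := _root_.exists_monodromy (ev := analyticUnitsEval P)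
    (fun g h hgh => Subtype.ext (funext hgh))
    (fun p hp => hasFuchsianFrame_analyticUnits hb hx hD hxD hbinf hp) x₀
  choose d hd hdeq using fun γ : Path x₀ x₀ =>
    (hol (FundamentalGroup.fromPath (Path.Homotopic.Quotient.mk γ))).2
  refine ⟨fun t q => if ht : t ∈ P then analyticUnitsEval P ⟨t, ht⟩ (Φ q) else 1, d, hd,
    fun t ht => ?_⟩
  simp only [dif_pos ht]
  refine ⟨(hΦ ⟨t, ht⟩).1, (hΦ ⟨t, ht⟩).2, fun γ => ⟨?_, ?_⟩⟩
  · rw [← hdeq γ ⟨t, ht⟩]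
    exact Units.ne_zero _
  · obtain ⟨F, hF, hF0, hF1⟩ := hcont γ ⟨t, ht⟩
    refine ⟨F, hF, hF0, fun q => ?_⟩
    rw [hF1, Units.val_mul, ← hdeq γ ⟨t, ht⟩]
    rfl

theorem GermAnalyticAt.units_inv {y : OnePoint ℂ → ℂˣ} {p : OnePoint ℂ}
    (hy : GermAnalyticAt (fun q => (y q : ℂ)) p) : GermAnalyticAt (fun q => (y q : ℂ)⁻¹) p :=
  AnalyticAt.inv hy (Units.ne_zero _)

/-- Twisting a local fundamental solution by a scalar solution. -/
theorem IsLocalFundamentalSolution.smul {b : Fin m → ℂ} {B : Fin m → Matrix (Fin n) (Fin n) ℂ}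
    {x : Fin m → ℂ} {p : OnePoint ℂ} {y : OnePoint ℂ → ℂ}
    {Y : OnePoint ℂ → Matrix (Fin n) (Fin n) ℂ} (hY : IsLocalFundamentalSolution B x p Y)
    (hya : GermAnalyticAt y p) (hys : SolvesNear b x y p) (hy0 : y p ≠ 0) :
    IsLocalFundamentalSolution (fun i => B i + b i • (1 : Matrix (Fin n) (Fin n) ℂ)) x p
      fun q => y q • Y q := by
  obtain ⟨h1, h2, h3⟩ := isLocalFundamentalSolution_iff.mp hY
  exact isLocalFundamentalSolution_iff.mpr
    ⟨AnalyticAt.smul hya h1, h2.smul (Units.mk0 _ hy0), hys.smul h3⟩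

/-- Twisting an analytic continuation by an analytic continuation of a scalar function. -/
theorem ContinuesTo.smul {γ : Path x₀ x₀} {Y : OnePoint ℂ → Matrix (Fin n) (Fin n) ℂ}
    {M : Matrix (Fin n) (Fin n) ℂ} (hY : ContinuesTo γ Y fun p => Y p * M)
    {f : unitInterval → OnePoint ℂ → ℂ} {y : OnePoint ℂ → ℂ} {d : ℂ}
    (hf : IsGermContinuation (fun s => (γ s : OnePoint ℂ)) f) (hf0 : ∀ q, f 0 q = y q)
    (hf1 : ∀ q, f 1 q = y q * d) :
    ContinuesTo γ (fun p => y p • Y p) fun p => (y p • Y p) * (d • M) := by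
  obtain ⟨F, hF, hF0, hF1⟩ := hY
  have hF := isAnalyticContinuation_iff.mp hF
  refine ⟨fun s q => f s q • F s q, isAnalyticContinuation_iff.mpr
    (hf.map₂ hF (fun a M => a • M) fun s => AnalyticAt.smul (hf.analytic s) (hF.analytic s)),
    ?_, ?_⟩
  · filter_upwards [hF0] with q hq
    rw [hq, hf0]
  · filter_upwards [hF1] with q hq
    rw [hq, hf1, smul_mul_smul_comm]

/-- If the residues have trace zero, then the monodromy matrices have determinant one: the
determinant of a local fundamental solution is constant. -/
theorem IsLocalFundamentalSolution.det_monodromy_eq_one {B : Fin m → Matrix (Fin n) (Fin n) ℂ}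
    {x : Fin m → ℂ} (hB : ∀ i, (B i).trace = 0) {Y : OnePoint ℂ → Matrix (Fin n) (Fin n) ℂ}
    (hY : IsLocalFundamentalSolution B x x₀ Y) {γ : Path x₀ x₀} {M : Matrix (Fin n) (Fin n) ℂ}
    (hM : ContinuesTo γ Y fun p => Y p * M) : M.det = 1 := by
  obtain ⟨hYa, hYu, hYs⟩ := isLocalFundamentalSolution_iff.mp hY
  obtain ⟨F, hF, hF0, hF1⟩ := hM
  have hF := isAnalyticContinuation_iff.mp hF
  have hone (p : OnePoint ℂ) : GermAnalyticAt (fun _ => (1 : ℂ)) p := analyticAt_const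
  have hdet : ∀ᶠ q in 𝓝 (x₀ : OnePoint ℂ), (Y q).det = (Y x₀).det := by
    have h1 := hYs.det (hYa.eventually_isUnit hYu)
    simp only [hB] at h1
    have h2 : SolvesNear (fun _ : Fin m => (0 : ℂ)) x (fun _ => ((1 : ℂˣ) : ℂ)) x₀ := by
      refine Eventually.of_forall fun z => ?_
      simpa using hasDerivAt_const z (1 : ℂ)
    have h3 := SolvesNear.eventually_eq_mul (U := fun _ => 1) h2 h1 (hone _) hYa.det
    simpa using h3
  have hconst : IsGermContinuation (fun s => (γ s : OnePoint ℂ)) fun _ _ => (Y x₀).det :=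
    ⟨fun s => analyticAt_const, fun s => Eventually.of_forall fun s' => EventuallyEq.rfl⟩
  have h4 := IsGermContinuation.eventuallyEq (continuous_coe_path γ)
    (hF.map Matrix.det fun s => (hF.analytic s).det) hconst
    (by
      rw [γ.source]
      filter_upwards [hF0, hdet] with q h1 h2
      rw [h1, h2]) 1
  rw [γ.target] at h4
  have h5 := h4.self_of_nhds
  beta_reduce at h5
  rw [hF1.self_of_nhds, Matrix.det_mul] at h5
  have h6 : (Y x₀).det ≠ 0 := ((Matrix.isUnit_iff_isUnit_det _).mp hYu).ne_zero
  exact mul_left_cancel₀ h6 (h5.trans (mul_one _).symm)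

/-- A continuous function with constant `k`-th power takes values in the finite set of `k`-th roots,
so it is constant on connected sets. -/
theorem IsPreconnected.eq_of_pow_eq {X : Type*} [TopologicalSpace X] {P : Set X}
    (hP : IsPreconnected P) {f : X → ℂ} (hf : ContinuousOn f P) {k : ℕ} (hk : 0 < k) {a : ℂ}
    (ha : ∀ t ∈ P, f t ^ k = a) {s t : X} (hs : s ∈ P) (ht : t ∈ P) : f s = f t := by
  have hfin : {z : ℂ | z ^ k = a}.Finite := by
    refine (Polynomial.nthRoots k a).toFinset.finite_toSet.subset fun z hz => ?_
    simpa [Polynomial.mem_nthRoots hk] using hz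
  have hdisc : IsDiscrete (f '' P) := (hfin.subset (Set.image_subset_iff.mpr ha)).isDiscrete
  exact (hP.image f hf).isDiscrete_iff_subsingleton.mp hdisc (Set.mem_image_of_mem f hs)
    (Set.mem_image_of_mem f ht)

theorem isLocalFundamentalSolution_zero_size {A : Fin m → Matrix (Fin 0) (Fin 0) ℂ}
    {x : Fin m → ℂ} {p : OnePoint ℂ} : IsLocalFundamentalSolution A x p fun _ => 1 :=
  ⟨fun k => k.elim0, isUnit_one, Eventually.of_forall fun _ k => k.elim0⟩

theorem continuesTo_zero_size {γ : Path x₀ x₀} {Y Z : OnePoint ℂ → Matrix (Fin 0) (Fin 0) ℂ} :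
    ContinuesTo γ Y Z := by
  have h (U V : OnePoint ℂ → Matrix (Fin 0) (Fin 0) ℂ) (l : Filter (OnePoint ℂ)) : U =ᶠ[l] V :=
    Eventually.of_forall fun _ => Subsingleton.elim _ _
  exact ⟨fun _ => Y, ⟨fun s k => k.elim0, fun s => Eventually.of_forall fun _ => h _ _ _⟩,
    h _ _ _, h _ _ _⟩

end Isomonodromy

/-! ### The criterion for projective isomonodromy -/

theorem IsClosedDisk.isClosed {X : Type*} [TopologicalSpace X] [T2Space X] {K : Set X}
    (hK : IsClosedDisk K) : IsClosed K := by
  obtain ⟨e⟩ := hK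
  have : CompactSpace (Metric.closedBall (0 : ℂ) 1) :=
    isCompact_iff_compactSpace.mp (isCompact_closedBall 0 1)
  have : CompactSpace K := e.symm.compactSpace
  exact (isCompact_iff_compactSpace.mpr this).isClosed

section Criterion

variable {m n r : ℕ} {D : Set (OnePoint ℂ)} {x₀ : D}

/-- The trace-free part of a projectively isomonodromic system is isomonodromic: along the
generator `γ i` its monodromy is a scalar multiple of `G i` of determinant one, so the scalar, being
continuous in `t`, is constant. -/
theorem IsProjectivelyIsomonodromic.isIsomonodromic_traceless {P : Set (Fin r → ℂ)}
    (hP : IsConnected P) (hD : IsOpen D) {γ : Fin m → Path x₀ x₀}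
    (hγ : Subgroup.closure (Set.range fun i =>
      FundamentalGroup.fromPath (Path.Homotopic.Quotient.mk (γ i))) = ⊤)
    {A : Fin m → (Fin r → ℂ) → Matrix (Fin n) (Fin n) ℂ} {x : Fin m → (Fin r → ℂ) → ℂ}
    (hx : ∀ i, AnalyticOnNhd ℂ (x i) P) (hxD : ∀ i, ∀ t ∈ P, (x i t : OnePoint ℂ) ∉ D)
    (hn : 0 < n) (hA : IsProjectivelyIsomonodromic P γ A x)
    {b : Fin m → (Fin r → ℂ) → ℂ} {B : Fin m → (Fin r → ℂ) → Matrix (Fin n) (Fin n) ℂ}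
    (hb : ∀ i, AnalyticOnNhd ℂ (b i) P)
    (hAB : ∀ i, ∀ t ∈ P, A i t = B i t + b i t • (1 : Matrix (Fin n) (Fin n) ℂ))
    (hBtr : ∀ i, ∀ t ∈ P, (B i t).trace = 0)
    (hbinf : OnePoint.infty ∈ D → ∀ t ∈ P, ∑ i, b i t = 0)
    (hBinf : OnePoint.infty ∈ D → ∀ t ∈ P, ∑ i, B i t = 0) :
    IsIsomonodromic P x₀ B x := by
  obtain ⟨c, G, hc, hc0, hY⟩ := hA
  obtain ⟨y, d, hd, hy⟩ := exists_scalar_monodromy hD x₀ hb hx hxD hbinf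
  have hW (t : Fin r → ℂ) (ht : t ∈ P) : ∃ W : OnePoint ℂ → Matrix (Fin n) (Fin n) ℂ,
      IsLocalFundamentalSolution (fun i => B i t) (fun i => x i t) x₀ W ∧
      ∀ i, ContinuesTo (γ i) W fun p =>
        W p * (((d (γ i) t)⁻¹ * c i t) • (G i : Matrix (Fin n) (Fin n) ℂ)) := by
    obtain ⟨Y, hYs, hYγ⟩ := hY t ht
    obtain ⟨hya, hys, hyγ⟩ := hy t ht
    refine ⟨fun q => (y t q : ℂ)⁻¹ • Y q, ?_, fun i => ?_⟩
    · have h1 := hYs.smul hya.units_inv hys.inv (inv_ne_zero (Units.ne_zero _))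
      have h2 : (fun i => A i t + -b i t • (1 : Matrix (Fin n) (Fin n) ℂ)) = fun i => B i t := by
        funext i
        rw [hAB i t ht, neg_smul, add_neg_cancel_right]
      rwa [h2] at h1
    · obtain ⟨-, F, hF, hF0, hF1⟩ := hyγ (γ i)
      rw [mul_smul]
      refine (hYγ i).smul (f := fun s q => (F s q : ℂ)⁻¹)
        (hF.map (fun a => a⁻¹) fun s => (hF.analytic s).units_inv) (fun q => ?_) (fun q => ?_)
      · rw [hF0]
      · rw [hF1, mul_inv]
  obtain ⟨t₀, ht₀⟩ := hP.nonempty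
  have hconst (i : Fin m) (t : Fin r → ℂ) (ht : t ∈ P) :
      (d (γ i) t)⁻¹ * c i t = (d (γ i) t₀)⁻¹ * c i t₀ := by
    refine hP.isPreconnected.eq_of_pow_eq (f := fun t => (d (γ i) t)⁻¹ * c i t)
      (a := ((G i : Matrix (Fin n) (Fin n) ℂ).det)⁻¹)
      (((hd (γ i)).continuousOn.inv₀ fun t ht => ((hy t ht).2.2 (γ i)).1).mul
        (hc i).continuousOn) hn (fun t ht => ?_) ht ht₀
    obtain ⟨W, hWs, hWγ⟩ := hW t ht
    have h1 := hWs.det_monodromy_eq_one (fun i => hBtr i t ht) (hWγ i)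
    rw [Matrix.det_smul, Fintype.card_fin] at h1
    exact eq_inv_of_mul_eq_one_left h1
  refine isIsomonodromic_of_generators ⟨t₀, ht₀⟩ hD hγ hxD hBinf
    (H := fun i => ((d (γ i) t₀)⁻¹ * c i t₀) • (G i : Matrix (Fin n) (Fin n) ℂ)) fun t ht => ?_
  obtain ⟨W, hWs, hWγ⟩ := hW t ht
  refine ⟨W, hWs, fun i => ?_⟩
  rw [← hconst i t ht]
  exact hWγ i

/-- Adding scalar matrices to the residues multiplies the monodromy by the monodromy of a scalar
equation, which is analytic in `t`. -/
theorem IsIsomonodromic.isProjectivelyIsomonodromic_add_smul {P : Set (Fin r → ℂ)} (hD : IsOpen D)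
    (γ : Fin m → Path x₀ x₀)
    {A B : Fin m → (Fin r → ℂ) → Matrix (Fin n) (Fin n) ℂ} {b x : Fin m → (Fin r → ℂ) → ℂ}
    (hx : ∀ i, AnalyticOnNhd ℂ (x i) P) (hxD : ∀ i, ∀ t ∈ P, (x i t : OnePoint ℂ) ∉ D)
    (hb : ∀ i, AnalyticOnNhd ℂ (b i) P)
    (hAB : ∀ i, ∀ t ∈ P, A i t = B i t + b i t • (1 : Matrix (Fin n) (Fin n) ℂ))
    (hbinf : OnePoint.infty ∈ D → ∀ t ∈ P, ∑ i, b i t = 0) (hB : IsIsomonodromic P x₀ B x) :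
    IsProjectivelyIsomonodromic P γ A x := by
  obtain ⟨χ, hχ⟩ := hB
  obtain ⟨y, d, hd, hy⟩ := exists_scalar_monodromy hD x₀ hb hx hxD hbinf
  refine ⟨fun i => d (γ i), fun i => χ (γ i), fun i => hd (γ i),
    fun i t ht => ((hy t ht).2.2 (γ i)).1, fun t ht => ?_⟩
  obtain ⟨Y, hYs, hYγ⟩ := hχ t ht
  obtain ⟨hya, hys, hyγ⟩ := hy t ht
  refine ⟨fun q => (y t q : ℂ) • Y q, ?_, fun i => ?_⟩
  · rw [show (fun i => A i t) = _ from funext fun i => hAB i t ht]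
    exact hYs.smul hya hys (Units.ne_zero _)
  · obtain ⟨-, F, hF, hF0, hF1⟩ := hyγ (γ i)
    exact (hYγ (γ i)).smul hF (fun q => by rw [hF0]) hF1

end Criterion

theorem proposition5p1 {m n r : ℕ}
    -- the parameter space
    (P : Set (Fin r → ℂ)) (hPo : IsOpen P) (hPs : SimplyConnectedSpace P)
    -- disjoint closed disks in the Riemann sphere, and the complement of their union, from which
    -- one may also remove the point at infinity
    (K : Fin m → Set (OnePoint ℂ)) (hK : ∀ i, IsClosedDisk (K i))
    (hKd : Pairwise fun i j => Disjoint (K i) (K j))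
    (D : Set (OnePoint ℂ))
    (hD : D = (⋃ i, K i)ᶜ ∨ D = (⋃ i, K i)ᶜ \ {OnePoint.infty})
    -- loops generating the fundamental group
    (x₀ : D) (γ : Fin m → Path x₀ x₀)
    (hγ : Subgroup.closure (Set.range fun i =>
      FundamentalGroup.fromPath (Path.Homotopic.Quotient.mk (γ i))) = ⊤)
    -- the Fuchsian system, analytic on `D × P`
    (A : Fin m → (Fin r → ℂ) → Matrix (Fin n) (Fin n) ℂ)
    (hA : ∀ i k l, AnalyticOnNhd ℂ (fun t => A i t k l) P)
    (x : Fin m → (Fin r → ℂ) → ℂ) (hx : ∀ i, AnalyticOnNhd ℂ (x i) P)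
    (hxK : ∀ i, ∀ t ∈ P, (x i t : OnePoint ℂ) ∈ K i)
    (hAinf : OnePoint.infty ∈ D → ∀ t ∈ P, ∑ i, A i t = 0) :
    IsProjectivelyIsomonodromic P γ A x ↔
      ∃ (b : Fin m → (Fin r → ℂ) → ℂ) (B : Fin m → (Fin r → ℂ) → Matrix (Fin n) (Fin n) ℂ),
        (∀ i, AnalyticOnNhd ℂ (b i) P) ∧
        (∀ i k l, AnalyticOnNhd ℂ (fun t => B i t k l) P) ∧
        (∀ i, ∀ t ∈ P, A i t = B i t + b i t • (1 : Matrix (Fin n) (Fin n) ℂ)) ∧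
        -- the system with residues `B i t` is again analytic on `D × P`
        (OnePoint.infty ∈ D → ∀ t ∈ P, ∑ i, B i t = 0) ∧
        IsIsomonodromic P x₀ B x := by
  have hD' : IsOpen D := by
    have hU : IsOpen (⋃ i, K i)ᶜ :=
      (isClosed_iUnion_of_finite fun i => (hK i).isClosed).isOpen_compl
    rcases hD with rfl | rfl
    · exact hU
    · exact hU.sdiff isClosed_singleton
  have hxD (i : Fin m) (t : Fin r → ℂ) (ht : t ∈ P) : (x i t : OnePoint ℂ) ∉ D := by
    have h : (x i t : OnePoint ℂ) ∉ (⋃ i, K i)ᶜ := fun h =>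
      h (Set.mem_iUnion.mpr ⟨i, hxK i t ht⟩)
    rcases hD with rfl | rfl
    · exact h
    · exact fun h' => h h'.1
  have hP : IsConnected P := isConnected_iff_connectedSpace.mpr inferInstance
  rcases Nat.eq_zero_or_pos n with rfl | hn
  -- for matrices of size zero both sides hold trivially
  · refine ⟨fun _ => ⟨fun _ _ => 0, A, fun i => analyticOnNhd_const, hA, fun i t _ =>
      Subsingleton.elim _ _, hAinf, fun _ => 1, fun t _ => ⟨fun _ => 1,
      isLocalFundamentalSolution_zero_size, fun _ => continuesTo_zero_size⟩⟩, fun _ => ?_⟩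
    exact ⟨fun _ _ => 1, fun _ => 1, fun _ => analyticOnNhd_const, fun _ _ _ => one_ne_zero,
      fun t _ => ⟨fun _ => 1, isLocalFundamentalSolution_zero_size, fun _ => continuesTo_zero_size⟩⟩
  have hn0 : (n : ℂ) ≠ 0 := Nat.cast_ne_zero.mpr hn.ne'
  constructor
  · intro h
    set b : Fin m → (Fin r → ℂ) → ℂ := fun i t => (n : ℂ)⁻¹ * (A i t).trace with hb
    have hba (i : Fin m) : AnalyticOnNhd ℂ (b i) P := fun t ht =>
      analyticAt_const.mul (Finset.analyticAt_fun_sum _ fun k _ => hA i k k t ht)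
    have hAB (i : Fin m) (t : Fin r → ℂ) (_ : t ∈ P) :
        A i t = (A i t - b i t • 1) + b i t • (1 : Matrix (Fin n) (Fin n) ℂ) :=
      (sub_add_cancel _ _).symm
    have hbinf (hinf : OnePoint.infty ∈ D) (t : Fin r → ℂ) (ht : t ∈ P) : ∑ i, b i t = 0 := by
      rw [hb, ← Finset.mul_sum, ← Matrix.trace_sum, hAinf hinf t ht, Matrix.trace_zero, mul_zero]
    have hBinf (hinf : OnePoint.infty ∈ D) (t : Fin r → ℂ) (ht : t ∈ P) :
        ∑ i, (A i t - b i t • (1 : Matrix (Fin n) (Fin n) ℂ)) = 0 := by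
      rw [Finset.sum_sub_distrib, ← Finset.sum_smul, hAinf hinf t ht, hbinf hinf t ht, zero_smul,
        sub_zero]
    refine ⟨b, fun i t => A i t - b i t • 1, hba, fun i k l t ht => ?_, hAB, hBinf,
      h.isIsomonodromic_traceless hP hD' hγ hx hxD hn hba hAB (fun i t _ => ?_) hbinf hBinf⟩
    · exact (hA i k l t ht).sub ((hba i t ht).mul analyticAt_const)
    · rw [Matrix.trace_sub, Matrix.trace_smul, Matrix.trace_one, Fintype.card_fin, hb, smul_eq_mul]
      field_simp
      ring
  · rintro ⟨b, B, hb, -, hAB, hBinf, hB⟩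
    refine hB.isProjectivelyIsomonodromic_add_smul hD' γ hx hxD hb hAB fun hinf t ht => ?_
    have h1 := hAinf hinf t ht
    rw [Finset.sum_congr rfl fun i _ => hAB i t ht, Finset.sum_add_distrib, hBinf hinf t ht,
      zero_add, ← Finset.sum_smul] at h1
    -- read off a diagonal entry, which exists as `0 < n`
    simpa using congrFun (congrFun h1 ⟨0, hn⟩) ⟨0, hn⟩
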